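/- **Notation.** Functions are real-valued, $\Omega\subseteq\mathbb R$ is a bounded open interval $(a,b)$ or $\mathbb R$, and $[\alpha]$ is the integer part of $\alpha>0$. For $\varphi\in C_0^\infty(\mathbb R)$ and $n=[\alpha]+1$ let $${}^{-}D^{\alpha}\varphi(x)=\frac{1}{\Gamma(n-\alpha)}\frac{d^n}{dx^n}\int_{-\infty}^x\frac{\varphi(y)}{(x-y)^{1+\alpha-n}}\,dy,\qquad {}^{+}D^{\alpha}\varphi(x)=\frac{(-1)^n}{\Gamma(n-\alpha)}\frac{d^n}{dx^n}\int_x^{\infty}\frac{\varphi(y)}{(y-x)^{1+\alpha-n}}\,dy$$ be the left and right Riemann–Liouville derivatives. A function $v\in L^1_{loc}(\Omega)$ is the left (resp. right) weak fractional derivative ${}^{\pm}\mathcal D^\alpha u$ of $u$ on $\Omega$ (sign $-$ for left, $+$ for right) if $$\int_\Omega v\,\varphi\,dx=(-1)^{[\alpha]}\int_\Omega u\;{}^{\mp}D^{\alpha}\tilde\varphi\,dx\qquad\text{for all }\varphi\in C_0^\infty(\Omega),$$ where $\tilde\varphi$ is the extension of $\varphi$ by zero to $\mathbb R$ and the integrals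 on the right converge absolutely. For $1\le p\le\infty$ and $m=[\alpha]$ let ${}^{\pm}W^{\alpha,p}(\Omega)=\{u\in W^{m,p}(\Omega): {}^{\pm}\mathcal D^\alpha u\in L^p(\Omega)\}$, with norm $\bigl(\|u\|_{W^{m,p}(\Omega)}^p+\|{}^{\pm}\mathcal D^\alpha u\|_{L^p(\Omega)}^p\bigr)^{1/p}$ for $p<\infty$ and $\|u\|_{W^{m,\infty}(\Omega)}+\|{}^{\pm}\mathcal D^\alpha u\|_{L^\infty(\Omega)}$ for $p=\infty$; here $\|u\|_{W^{m,p}}=\bigl(\sum_{k=0}^m\|\mathcal D^ku\|_{L^p}^p\bigr)^{1/p}$ for $p<\infty$ and $\sum_{k=0}^m\|\mathcal D^ku\|_{L^\infty}$ for $p=\infty$. The support of (the class of) a function is the complement of the largest open set on which it vanishes almost everywhere. **Theorem (interior extension).** Let $\Omega=(a,b)$ be a bounded open interval. For each $\Omega'\subset\subset\Omega$ (that is, $\overline{\Omega'}$ is compact and contained in $\Omega$) there is a compact set $K\subset\Omega$ such that, for all $\alpha>0$ and $1\le p\le\infty$, there is a constant $C=C(\alpha,p,K)>0$ (for the fixed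 interval $\Omega$, it depends only on $\alpha$, $p$ and $K$) with the following property: for each choice of the sign $\pm$ there is a mapping $E:{}^{\pm}W^{\alpha,p}(\Omega)\to{}^{\pm}W^{\alpha,p}(\mathbb R)$ such that for every $u\in{}^{\pm}W^{\alpha,p}(\Omega)$ 1. $Eu=u$ a.e. in $\Omega'$, 2. $\operatorname{supp}(Eu)\subseteq K$, 3. $\|Eu\|_{{}^{\pm}W^{\alpha,p}(\mathbb R)}\le C\,\|u\|_{{}^{\pm}W^{\alpha,p}(\Omega)}$. -/

import Mathlib

open MeasureTheory Set
open scoped ENNReal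

noncomputable section

namespace FracSob

/-- Direction of a one-sided fractional operator: `left` is the superscript `-`,
`right` is the superscript `+`. -/
inductive Side where
  | left
  | right

/-- The opposite direction. -/
def Side.opp : Side → Side
  | .left => .right
  | .right => .left

/-- Test functions `φ ∈ C₀^∞(Ω)`, each regarded as a function on `ℝ` through its extension
by zero. -/
def IsTestFunction (Ω : Set ℝ) (φ : ℝ → ℝ) : Prop :=
  ContDiff ℝ ((⊤ : ℕ∞) : WithTop ℕ∞) φ ∧ HasCompactSupport φ ∧ tsupport φ ⊆ Ω

/-- One-sided Riemann–Liouville fractional integral of order `γ > 0` on `ℝ`: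
`Γ(γ)⁻¹ ∫_{-∞}^x (x - y)^{γ-1} φ(y) dy` (left) and
`Γ(γ)⁻¹ ∫_x^∞ (y - x)^{γ-1} φ(y) dy` (right). -/
def rlIntegral : Side → ℝ → (ℝ → ℝ) → ℝ → ℝ
  | .left, γ, φ, x => (Real.Gamma γ)⁻¹ * ∫ y in Iio x, (x - y) ^ (γ - 1) * φ y
  | .right, γ, φ, x => (Real.Gamma γ)⁻¹ * ∫ y in Ioi x, (y - x) ^ (γ - 1) * φ y

/-- Classical one-sided Riemann–Liouville derivative of order `α > 0` on `ℝ`, with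
`n = [α] + 1`: `(d/dx)^n` of the left integral of order `n - α`, respectively
`(-1)^n (d/dx)^n` of the right integral of order `n - α`.
It is only applied to smooth compactly supported functions. -/
def rlDeriv : Side → ℝ → (ℝ → ℝ) → ℝ → ℝ
  | .left, α, φ, x =>
      iteratedDeriv (⌊α⌋₊ + 1) (rlIntegral .left ((⌊α⌋₊ : ℝ) + 1 - α) φ) x
  | .right, α, φ, x =>
      (-1) ^ (⌊α⌋₊ + 1) * iteratedDeriv (⌊α⌋₊ + 1) (rlIntegral .right ((⌊α⌋₊ : ℝ) + 1 - α) φ) x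

/-- `v` is the weak derivative of integer order `k` of `u` on `Ω`. -/
def IsWeakDeriv (k : ℕ) (Ω : Set ℝ) (u v : ℝ → ℝ) : Prop :=
  LocallyIntegrableOn v Ω ∧ ∀ φ, IsTestFunction Ω φ →
    ∫ x in Ω, v x * φ x = (-1) ^ k * ∫ x in Ω, u x * iteratedDeriv k φ x

/-- `v` is the weak fractional derivative of order `α` of `u` on `Ω` in the direction `s`:
`∫_Ω v φ = (-1)^{[α]} ∫_Ω u D^α φ` for all test functions `φ` on `Ω`, where `D^α` is the
classical derivative in the direction opposite to `s`, applied to the extension of `φ` by zero.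
Since `D^α φ` need not have compact support, the convergence of the right-hand integral is
part of the definition. -/
def IsWeakFracDeriv (s : Side) (α : ℝ) (Ω : Set ℝ) (u v : ℝ → ℝ) : Prop :=
  LocallyIntegrableOn v Ω ∧ ∀ φ, IsTestFunction Ω φ →
    IntegrableOn (fun x => u x * rlDeriv s.opp α φ x) Ω ∧
    ∫ x in Ω, v x * φ x = (-1) ^ ⌊α⌋₊ * ∫ x in Ω, u x * rlDeriv s.opp α φ x

theorem ae_eq_of_test {Ω : Set ℝ} (hΩ : IsOpen Ω) {v w : ℝ → ℝ}
    (hv : LocallyIntegrableOn v Ω) (hw : LocallyIntegrableOn w Ω)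
    (h : ∀ φ, IsTestFunction Ω φ → ∫ x in Ω, v x * φ x = ∫ x in Ω, w x * φ x) :
    v =ᵐ[volume.restrict Ω] w := by
  have key : ∀ᵐ x, x ∈ Ω → (v - w) x = 0 := by
    refine hΩ.ae_eq_zero_of_integral_contDiff_smul_eq_zero (hv.sub hw) ?_
    intro g hg hgc hgs
    have hz : ∀ f : ℝ → ℝ, ∀ x, x ∉ Ω → f x * g x = 0 := fun f x hx => by
      rw [image_eq_zero_of_notMem_tsupport (fun hx' => hx (hgs hx')), mul_zero]
    have hi : ∀ f : ℝ → ℝ, LocallyIntegrableOn f Ω →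
        Integrable (fun x => f x * g x) := fun f hf => by
      have h1 : IntegrableOn (fun x => f x * g x) (tsupport g) :=
        (hf.integrableOn_compact_subset hgs hgc).mul_continuousOn
          hg.continuous.continuousOn hgc
      refine (integrableOn_iff_integrable_of_support_subset ?_).1 h1
      intro x hx
      by_contra hx'
      exact hx (by simp [image_eq_zero_of_notMem_tsupport hx'])
    have e := h g ⟨hg, hgc, hgs⟩
    rw [setIntegral_eq_integral_of_forall_compl_eq_zero (hz v),
      setIntegral_eq_integral_of_forall_compl_eq_zero (hz w)] at e
    have : (fun x => g x • (v - w) x) = fun x => v x * g x - w x * g x := by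
      funext x; simp; ring
    rw [this, integral_sub (hi v hv) (hi w hw), e, sub_self]
  filter_upwards [ae_restrict_of_ae key, ae_restrict_mem hΩ.measurableSet] with x hx hxΩ
  exact sub_eq_zero.1 (hx hxΩ)

/-- Weak derivatives of integer order are unique up to null sets. -/
theorem IsWeakDeriv.unique {k : ℕ} {Ω : Set ℝ} (hΩ : IsOpen Ω) {u v w : ℝ → ℝ}
    (hv : IsWeakDeriv k Ω u v) (hw : IsWeakDeriv k Ω u w) : v =ᵐ[volume.restrict Ω] w :=
  ae_eq_of_test hΩ hv.1 hw.1 fun φ hφ => by rw [hv.2 φ hφ, hw.2 φ hφ]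

/-- Weak fractional derivatives are unique up to null sets. -/
theorem IsWeakFracDeriv.unique {s : Side} {α : ℝ} {Ω : Set ℝ} (hΩ : IsOpen Ω)
    {u v w : ℝ → ℝ} (hv : IsWeakFracDeriv s α Ω u v) (hw : IsWeakFracDeriv s α Ω u w) :
    v =ᵐ[volume.restrict Ω] w :=
  ae_eq_of_test hΩ hv.1 hw.1 fun φ hφ => by rw [(hv.2 φ hφ).2, (hw.2 φ hφ).2]

/-- The space `L^p(Ω)` of classes of real functions. -/
abbrev LpOn (p : ℝ≥0∞) (Ω : Set ℝ) : Type := Lp ℝ p (volume.restrict Ω)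

/-- The integer-order Sobolev space `W^{m,p}(Ω)`. -/
def sobolevSpace (m : ℕ) (p : ℝ≥0∞) (Ω : Set ℝ) : Set (LpOn p Ω) :=
  {u | ∀ k ≤ m, ∃ v : LpOn p Ω, IsWeakDeriv k Ω u v}

/-- The fractional Sobolev space `^∓W^{α,p}(Ω)` of direction `s`: functions in `W^{m,p}(Ω)`,
`m = [α]`, whose weak fractional derivative of order `α` exists and lies in `L^p(Ω)`. -/
def fracSobolevSpace (s : Side) (α : ℝ) (p : ℝ≥0∞) (Ω : Set ℝ) : Set (LpOn p Ω) :=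
  {u | u ∈ sobolevSpace ⌊α⌋₊ p Ω ∧ ∃ v : LpOn p Ω, IsWeakFracDeriv s α Ω u v}

open Classical in
/-- The (unique) weak derivative of order `k` in `L^p(Ω)`, if there is one. -/
def weakDeriv (k : ℕ) {p : ℝ≥0∞} {Ω : Set ℝ} (u : LpOn p Ω) : LpOn p Ω :=
  if h : ∃ v : LpOn p Ω, IsWeakDeriv k Ω u v then h.choose else 0

open Classical in
/-- The (unique) weak fractional derivative of order `α` in `L^p(Ω)`, if there is one. -/
def weakFracDeriv (s : Side) (α : ℝ) {p : ℝ≥0∞} {Ω : Set ℝ} (u : LpOn p Ω) : LpOn p Ω :=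
  if h : ∃ v : LpOn p Ω, IsWeakFracDeriv s α Ω u v then h.choose else 0

/-- The norm of `W^{m,p}(Ω)`: `(∑_{k ≤ m} ‖D^k u‖_p^p)^{1/p}` for `p < ∞` and
`∑_{k ≤ m} ‖D^k u‖_∞` for `p = ∞`. -/
def sobolevNorm (m : ℕ) {p : ℝ≥0∞} {Ω : Set ℝ} (u : LpOn p Ω) : ℝ :=
  if p = ⊤ then ∑ k ∈ Finset.range (m + 1), ‖weakDeriv k u‖
  else (∑ k ∈ Finset.range (m + 1), ‖weakDeriv k u‖ ^ p.toReal) ^ (1 / p.toReal)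

/-- The norm of the fractional Sobolev space of direction `s`. -/
def fracSobolevNorm (s : Side) (α : ℝ) {p : ℝ≥0∞} {Ω : Set ℝ} (u : LpOn p Ω) : ℝ :=
  if p = ⊤ then sobolevNorm ⌊α⌋₊ u + ‖weakFracDeriv s α u‖
  else (sobolevNorm ⌊α⌋₊ u ^ p.toReal + ‖weakFracDeriv s α u‖ ^ p.toReal) ^ (1 / p.toReal)

/-- The support of (the class of) a function on `ℝ`: the complement of the largest open set on
which it vanishes almost everywhere. -/
def essSupport (f : ℝ → ℝ) : Set ℝ :=
  {x | ∀ U : Set ℝ, IsOpen U → x ∈ U → ¬ ∀ᵐ y, y ∈ U → f y = 0}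

end FracSob

end

namespace FracSob

open Filter Topology
open scoped NNReal

-- The extension is multiplication by a cutoff: `E u = ψ u` with `ψ ∈ C₀^∞(Ω)` equal to `1` on `Ω'`.
-- The integer derivatives follow from the Leibniz rule; the substance is that `ψ u` has a
-- fractional derivative in `L^p(ℝ)`, although the operator is nonlocal and `u` lives only on `Ω`.
--
-- Put `m = [α]`, `σ = α - m ∈ [0,1)`, `e = ±1` and `S η (x) = ∫_0^∞ t^(-σ) η(x + e t) dt`, so that
-- `D^α φ` is a constant times `S φ^(m+1)`. Take a second cutoff `χ`, equal to `1` near the support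
-- of `ψ`, and let `U = χ u`, so `ψ u = ψ U`. Moving `m` derivatives onto `ψ U` leaves `∫ (ψ U)^(m)
-- S φ'`, which splits into four pieces.
--
-- (1) The commutator `ψ S φ' - S (ψ φ)'`, tested against `U^(m)`: its kernel `t^(-σ-1) (ψ(x) - ψ(x
-- + e t))` is only weakly singular (`exists_commutator_transpose`). (2) The lower-order Leibniz
-- terms of `(ψ U)^(m)`: they have one more weak derivative in `L^p`, hence a derivative of order
-- `σ` (`exists_fracDeriv_of_weakDeriv`). (3) `∫ U^(m) S (ψ φ)'`: undoing the integrations by parts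
-- and replacing `χ u` by `u` on `Ω`, this is the defining identity of the fractional derivative of
-- `u` for the test function `ψ φ`. (4) The error `(1 - χ) u` from that replacement: it stays away
-- from the support of `ψ`, so the singularity of the kernel is never met
-- (`exists_offDiagonal_transpose`).
--
-- In (1), (2) and (4) the kernels that arise are dominated by an integrable function of `t`, and
-- Young's inequality (`exists_transpose_kernel`) gives the required `L^p` function, with constants
-- independent of `u`. `exists_weakFracDeriv_mul` assembles the pieces.

local notation "∞ω" => ((⊤ : ℕ∞) : WithTop ℕ∞)

/-! ### Test functions. -/

theorem contDiff_iteratedDeriv {f : ℝ → ℝ} (hf : ContDiff ℝ ∞ω f) (k : ℕ) :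
    ContDiff ℝ ∞ω (iteratedDeriv k f) := by
  rw [iteratedDeriv_eq_iterate]
  exact hf.iterate_deriv k

theorem IsTestFunction.deriv {Ω : Set ℝ} {φ : ℝ → ℝ} (h : IsTestFunction Ω φ) :
    IsTestFunction Ω (deriv φ) :=
  ⟨by simpa using contDiff_iteratedDeriv h.1 1, h.2.1.deriv,
    (tsupport_deriv_subset).trans h.2.2⟩

theorem IsTestFunction.iteratedDeriv {Ω : Set ℝ} {φ : ℝ → ℝ} (h : IsTestFunction Ω φ) (k : ℕ) :
    IsTestFunction Ω (iteratedDeriv k φ) := by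
  induction k with
  | zero => simpa using h
  | succ k ih => rw [iteratedDeriv_succ]; exact ih.deriv

theorem IsTestFunction.mono {Ω Ω' : Set ℝ} {φ : ℝ → ℝ} (h : IsTestFunction Ω φ) (hs : Ω ⊆ Ω') :
    IsTestFunction Ω' φ :=
  ⟨h.1, h.2.1, h.2.2.trans hs⟩

theorem IsTestFunction.univ {Ω : Set ℝ} {φ : ℝ → ℝ} (h : IsTestFunction Ω φ) :
    IsTestFunction univ φ :=
  h.mono (subset_univ _)

theorem IsTestFunction.mul_smooth {Ω : Set ℝ} {ψ φ : ℝ → ℝ} (hψ : IsTestFunction Ω ψ)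
    (hφ : ContDiff ℝ ∞ω φ) : IsTestFunction Ω (fun x => ψ x * φ x) :=
  ⟨hψ.1.mul hφ, hψ.2.1.mul_right, (tsupport_mul_subset_left).trans hψ.2.2⟩

theorem IsTestFunction.continuous {Ω : Set ℝ} {φ : ℝ → ℝ} (h : IsTestFunction Ω φ) :
    Continuous φ := h.1.continuous

theorem IsTestFunction.differentiable {Ω : Set ℝ} {φ : ℝ → ℝ} (h : IsTestFunction Ω φ) :
    Differentiable ℝ φ := h.1.differentiable (by simp)

theorem IsTestFunction.hasDerivAt {Ω : Set ℝ} {φ : ℝ → ℝ} (h : IsTestFunction Ω φ) (x : ℝ) :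
    HasDerivAt φ (_root_.deriv φ x) x := (h.differentiable x).hasDerivAt

theorem exists_bound {φ : ℝ → ℝ} (h : Continuous φ) (hc : HasCompactSupport φ) :
    ∃ C, 0 ≤ C ∧ ∀ x, |φ x| ≤ C := by
  obtain ⟨C, hC⟩ := hc.exists_bound_of_continuous h
  exact ⟨C, (abs_nonneg _).trans (hC 0), hC⟩

theorem exists_radius {φ : ℝ → ℝ} (hc : HasCompactSupport φ) :
    ∃ R, 0 < R ∧ ∀ x, R < |x| → φ x = 0 := by
  obtain ⟨R, hR, hs⟩ := hc.isBounded.exists_pos_norm_le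
  refine ⟨R, hR, fun x hx => ?_⟩
  by_contra h
  exact absurd (hs x (subset_tsupport _ h)) (not_le.2 hx)

theorem hasCompactSupport_of_radius {φ : ℝ → ℝ} {R : ℝ} (h : ∀ x, R < |x| → φ x = 0) :
    HasCompactSupport φ := by
  refine HasCompactSupport.of_support_subset_isCompact (isCompact_closedBall (0 : ℝ) R) ?_
  intro x hx
  by_contra h'
  exact hx (h x (by simpa using h'))

/-! ### One-sided integral operators and the Riemann–Liouville derivative of a test function. -/

/-- The one-sided integral operator `η ↦ ∫_0^∞ κ(t) η(x + e t) dt`. -/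
noncomputable def oneSided (e : ℝ) (κ η : ℝ → ℝ) (x : ℝ) : ℝ :=
  ∫ t in Ioi 0, κ t * η (x + e * t)

section
variable {e : ℝ} {κ : ℝ → ℝ}

theorem oneSided_eq_zero_of_far (he : |e| = 1) {η : ℝ → ℝ} {R : ℝ}
    (hR : ∀ x, R < |x| → η x = 0) {x t : ℝ} (ht : |x| + R < t) : η (x + e * t) = 0 := by
  apply hR
  have h1 : |e * t| ≤ |x + e * t| + |x| := by
    have := abs_sub (x + e * t) x
    simpa using this
  rw [abs_mul, he, one_mul] at h1
  have := le_abs_self t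
  linarith

theorem integrableOn_oneSided (he : |e| = 1) (hκ : ∀ R, IntegrableOn κ (Ioc 0 R))
    {η : ℝ → ℝ} (hη : Continuous η) (hc : HasCompactSupport η) (x : ℝ) :
    IntegrableOn (fun t => κ t * η (x + e * t)) (Ioi 0) := by
  obtain ⟨R, hR, h0⟩ := exists_radius hc
  obtain ⟨C, hC, hb⟩ := exists_bound hη hc
  have h1 : IntegrableOn (fun t => κ t * η (x + e * t)) (Ioc 0 (|x| + R)) := by
    refine (hκ (|x| + R)).mul_bdd (c := C) ?_ ?_
    · exact (by fun_prop : Continuous fun t => η (x + e * t)).aestronglyMeasurable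
    · exact ae_of_all _ fun t => hb _
  refine h1.of_forall_sdiff_eq_zero measurableSet_Ioi ?_
  rintro t ⟨ht, ht'⟩
  rw [oneSided_eq_zero_of_far he h0, mul_zero]
  by_contra h
  exact ht' ⟨ht, not_lt.1 h⟩

/-- The operator averages translates, so it commutes with differentiation. -/
theorem hasDerivAt_oneSided (he : |e| = 1) (hκ : ∀ R, IntegrableOn κ (Ioc 0 R))
    {η : ℝ → ℝ} (hη : IsTestFunction univ η) (x : ℝ) :
    HasDerivAt (oneSided e κ η) (oneSided e κ (deriv η) x) x := by
  obtain ⟨R, hR, h0⟩ := exists_radius hη.deriv.2.1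
  obtain ⟨C, hC, hb⟩ := exists_bound hη.deriv.continuous hη.deriv.2.1
  have hmeas : AEStronglyMeasurable κ (volume.restrict (Ioi 0)) := by
    have : (Ioi (0:ℝ)) = ⋃ n : ℕ, Ioc 0 (n : ℝ) := by
      ext t
      simp only [mem_Ioi, mem_iUnion, mem_Ioc, exists_and_left]
      exact ⟨fun h => ⟨h, exists_nat_ge t⟩, fun h => h.1⟩
    rw [this]
    exact AEStronglyMeasurable.iUnion fun n => (hκ n).aestronglyMeasurable
  refine (hasDerivAt_integral_of_dominated_loc_of_deriv_le
    (F := fun x t => κ t * η (x + e * t)) (F' := fun x t => κ t * deriv η (x + e * t))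
    -- For `y` within distance `1` of `x`, the integrand vanishes once `t > |x| + 1 + R`, so one
    -- compactly supported bound serves the whole ball.
    (bound := (Ioc 0 (|x| + 1 + R)).indicator fun t => |κ t| * C)
    (Metric.ball_mem_nhds x one_pos) ?_ ?_ ?_ ?_ ?_ ?_).2
  · refine Eventually.of_forall fun y => hmeas.mul ?_
    have := hη.continuous
    exact (by fun_prop : Continuous fun t => η (y + e * t)).aestronglyMeasurable
  · exact integrableOn_oneSided he hκ hη.continuous hη.2.1 x
  · refine hmeas.mul ?_
    have := hη.deriv.continuous
    exact (by fun_prop : Continuous fun t => deriv η (x + e * t)).aestronglyMeasurable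
  · filter_upwards [ae_restrict_mem measurableSet_Ioi] with t ht y hy
    have hy' : |y| < |x| + 1 := by
      have := abs_sub_abs_le_abs_sub y x
      rw [Metric.mem_ball, Real.dist_eq] at hy
      linarith
    by_cases hm : t ≤ |x| + 1 + R
    · rw [indicator_of_mem (show t ∈ Ioc 0 (|x| + 1 + R) from ⟨ht, hm⟩), norm_mul]
      exact mul_le_mul_of_nonneg_left (hb _) (abs_nonneg _)
    · rw [oneSided_eq_zero_of_far he h0 (show |y| + R < t by linarith), mul_zero, norm_zero]
      exact indicator_nonneg (fun s _ => by positivity) _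
  · exact (IntegrableOn.integrable_indicator ((hκ _).abs.mul_const C) measurableSet_Ioc).restrict
  · refine ae_of_all _ fun t y _ => ?_
    have := (hη.hasDerivAt (y + e * t)).comp_add_const y (e * t)
    exact this.const_mul (κ t)

theorem iteratedDeriv_oneSided (he : |e| = 1) (hκ : ∀ R, IntegrableOn κ (Ioc 0 R))
    {η : ℝ → ℝ} (hη : IsTestFunction univ η) (k : ℕ) :
    iteratedDeriv k (oneSided e κ η) = oneSided e κ (iteratedDeriv k η) := by
  induction k with
  | zero => simp
  | succ k ih =>
    rw [iteratedDeriv_succ, iteratedDeriv_succ, ih]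
    funext x
    exact (hasDerivAt_oneSided he hκ (hη.iteratedDeriv k) x).deriv

theorem contDiff_oneSided (he : |e| = 1) (hκ : ∀ R, IntegrableOn κ (Ioc 0 R))
    {η : ℝ → ℝ} (hη : IsTestFunction univ η) : ContDiff ℝ ∞ω (oneSided e κ η) := by
  refine contDiff_of_differentiable_iteratedDeriv fun k _ x => ?_
  rw [iteratedDeriv_oneSided he hκ hη]
  exact (hasDerivAt_oneSided he hκ (hη.iteratedDeriv k) x).differentiableAt

/-- A truncated kernel enlarges supports by at most `T`. This lets the near part of a fractional
integral of a test function serve as a test function itself. -/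
theorem isTestFunction_oneSided (he : |e| = 1) (hκ : ∀ R, IntegrableOn κ (Ioc 0 R)) {T : ℝ}
    (hT : ∀ t, T < t → κ t = 0)
    {η : ℝ → ℝ} (hη : IsTestFunction univ η) : IsTestFunction univ (oneSided e κ η) := by
  refine ⟨contDiff_oneSided he hκ hη, ?_, subset_univ _⟩
  obtain ⟨R, hR, h0⟩ := exists_radius hη.2.1
  refine hasCompactSupport_of_radius (R := T + R) fun x hx => ?_
  refine (setIntegral_congr_fun measurableSet_Ioi (g := fun _ => 0) fun t ht => ?_).trans (by simp)
  by_cases h : T < t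
  · simp [hT t h]
  · have : η (x + e * t) = 0 := by
      apply h0
      have h1 : |x| ≤ |x + e * t| + |e * t| := by
        have := abs_sub (x + e * t) (e * t)
        simpa using this
      rw [abs_mul, he, one_mul, abs_of_pos (mem_Ioi.1 ht)] at h1
      linarith
    simp [this]

end

/-- The direction in which a one-sided operator looks: backwards for the left operators. -/
def Side.dir : Side → ℝ
  | .left => -1
  | .right => 1

theorem Side.abs_dir (s : Side) : |s.dir| = 1 := by cases s <;> simp [Side.dir]

/-- The substitution `y = x + e t` puts both directions into one operator with `e = ±1`; from here
on the two sides are treated together. -/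
theorem rlIntegral_eq (s : Side) (γ : ℝ) (φ : ℝ → ℝ) :
    rlIntegral s γ φ = fun x => (Real.Gamma γ)⁻¹ * oneSided s.dir (fun t => t ^ (γ - 1)) φ x := by
  funext x
  cases s
  · simp only [rlIntegral, oneSided, Side.dir]
    congr 1
    rw [← integral_indicator measurableSet_Iio, ← integral_indicator measurableSet_Ioi,
      ← integral_sub_left_eq_self _ volume x]
    congr 1 with t
    simp only [indicator, mem_Iio, mem_Ioi, sub_lt_self_iff]
    split_ifs <;> [(congr 2 <;> ring_nf); rfl]
  · simp only [rlIntegral, oneSided, Side.dir]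
    congr 1
    rw [← integral_indicator measurableSet_Ioi, ← integral_indicator measurableSet_Ioi,
      ← integral_add_left_eq_self _ x]
    congr 1 with t
    simp only [indicator, mem_Ioi]
    simp only [lt_add_iff_pos_right]
    split_ifs <;> [(congr 2 <;> ring_nf); rfl]

theorem integrableOn_rpow_Ioc {r : ℝ} (hr : -1 < r) (R : ℝ) :
    IntegrableOn (fun t : ℝ => t ^ r) (Ioc 0 R) := by
  rcases le_or_gt R 0 with h | h
  · simp [Ioc_eq_empty (not_lt.2 h)]
  · exact (intervalIntegrable_iff_integrableOn_Ioc_of_le h.le).1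
      (intervalIntegral.intervalIntegrable_rpow' hr)

/-- All derivatives fall on `φ`, leaving the locally integrable kernel `t^(-σ)` with `σ = α - [α] <
1`. The factor `(-s.dir)^n` is `1` on the left and `(-1)^n` on the right. -/
theorem rlDeriv_eq (s : Side) (α : ℝ) {φ : ℝ → ℝ} (hφ : IsTestFunction univ φ) :
    rlDeriv s α φ = fun x => (-s.dir) ^ (⌊α⌋₊ + 1) * (Real.Gamma (⌊α⌋₊ + 1 - α))⁻¹ *
      oneSided s.dir (fun t => t ^ (-(α - ⌊α⌋₊))) (iteratedDeriv (⌊α⌋₊ + 1) φ) x := by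
  have hσ : -1 < -(α - ⌊α⌋₊) := by linarith [Nat.lt_floor_add_one α]
  have hexp : (⌊α⌋₊ : ℝ) + 1 - α - 1 = -(α - ⌊α⌋₊) := by ring
  have key : ∀ x, iteratedDeriv (⌊α⌋₊ + 1) (rlIntegral s ((⌊α⌋₊ : ℝ) + 1 - α) φ) x =
      (Real.Gamma (⌊α⌋₊ + 1 - α))⁻¹ *
      oneSided s.dir (fun t => t ^ (-(α - ⌊α⌋₊))) (iteratedDeriv (⌊α⌋₊ + 1) φ) x := by
    intro x
    rw [rlIntegral_eq, hexp, iteratedDeriv_const_mul_field,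
      iteratedDeriv_oneSided s.abs_dir (integrableOn_rpow_Ioc hσ) hφ]
  funext x
  cases s
  · simp only [rlDeriv, key]
    simp [Side.dir]
  · simp only [rlDeriv, key]
    simp only [Side.dir]
    ring

/-! ### Young's inequality and transposes of one-sided operators. -/

theorem measurePreserving_sub_dir {e : ℝ} (he : |e| = 1) (y : ℝ) :
    MeasurePreserving (fun t => y - e * t) volume volume := by
  rcases abs_eq (zero_le_one) |>.1 he with rfl | rfl
  · simpa using Measure.measurePreserving_sub_left volume y
  · simpa using measurePreserving_add_left volume y

/-- Young's inequality for the average of translates against a finite measure. -/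
theorem eLpNorm_lintegral_translate_le {e : ℝ} (he : |e| = 1) {ν : Measure ℝ} [IsFiniteMeasure ν]
    (hν : ν ≪ volume) {p : ℝ≥0∞} (hp : 1 ≤ p) {f : ℝ → ℝ} (hf : StronglyMeasurable f) :
    eLpNorm (fun y => ∫⁻ t, ‖f (y - e * t)‖ₑ ∂ν) p volume ≤ ν univ * eLpNorm f p volume := by
  have hfm := hf.measurable
  have hsub : ∀ y, Measurable fun t => y - e * t := fun y => by fun_prop
  rcases eq_or_ne p ∞ with rfl | hpt
  · simp only [eLpNorm_exponent_top]
    refine eLpNormEssSup_le_of_ae_enorm_bound (ae_of_all _ fun y => ?_)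
    have h1 : ∀ᵐ t ∂ν, ‖f (y - e * t)‖ₑ ≤ eLpNormEssSup f volume :=
      hν.ae_le ((measurePreserving_sub_dir he y).quasiMeasurePreserving.ae
        (ae_le_eLpNormEssSup (f := f)))
    rw [enorm_eq_self]
    calc _ ≤ ∫⁻ _, eLpNormEssSup f volume ∂ν := lintegral_mono_ae h1
      _ = _ := by rw [lintegral_const, mul_comm]
  · have hp0 : p ≠ 0 := (zero_lt_one.trans_le hp).ne'
    have hpr : 1 ≤ p.toReal := by
      simpa using (ENNReal.toReal_le_toReal (by simp) hpt).2 hp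
    have hpr0 : 0 < p.toReal := by linarith
    rw [eLpNorm_eq_lintegral_rpow_enorm_toReal hp0 hpt,
      eLpNorm_eq_lintegral_rpow_enorm_toReal hp0 hpt]
    -- Hölder against the constant `1` on the finite measure `ν`; Tonelli and translation invariance
    -- then supply the last factor `ν univ`.
    have h1 : ∀ y, (∫⁻ t, ‖f (y - e * t)‖ₑ ∂ν) ^ p.toReal ≤
        ν univ ^ (p.toReal - 1) * ∫⁻ t, ‖f (y - e * t)‖ₑ ^ p.toReal ∂ν := by
      intro y
      have := eLpNorm_le_eLpNorm_mul_rpow_measure_univ (μ := ν) hp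
        ((hf.comp_measurable (hsub y)).aestronglyMeasurable)
      rw [eLpNorm_one_eq_lintegral_enorm, eLpNorm_eq_lintegral_rpow_enorm_toReal hp0 hpt] at this
      have h2 := ENNReal.rpow_le_rpow this hpr0.le
      rw [ENNReal.mul_rpow_of_nonneg _ _ hpr0.le, ← ENNReal.rpow_mul, ← ENNReal.rpow_mul,
        one_div_mul_cancel hpr0.ne', ENNReal.rpow_one, ENNReal.toReal_one, sub_mul,
        one_div_mul_cancel hpr0.ne', mul_comm] at h2
      simpa using h2
    have h3 : ∫⁻ y, (∫⁻ t, ‖f (y - e * t)‖ₑ ∂ν) ^ p.toReal ≤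
        ν univ ^ p.toReal * ∫⁻ x, ‖f x‖ₑ ^ p.toReal := by
      calc _ ≤ ∫⁻ y, ν univ ^ (p.toReal - 1) * ∫⁻ t, ‖f (y - e * t)‖ₑ ^ p.toReal ∂ν :=
            lintegral_mono h1
        _ = ν univ ^ (p.toReal - 1) * ∫⁻ y, ∫⁻ t, ‖f (y - e * t)‖ₑ ^ p.toReal ∂ν := by
            refine lintegral_const_mul' _ _ ?_
            exact ENNReal.rpow_ne_top_of_nonneg (by linarith) (measure_ne_top _ _)
        _ = ν univ ^ (p.toReal - 1) * ∫⁻ t, ∫⁻ y, ‖f (y - e * t)‖ₑ ^ p.toReal ∂volume ∂ν := by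
            rw [lintegral_lintegral_swap]
            exact (Measurable.pow_const (hfm.comp (by fun_prop)).enorm _).aemeasurable
        _ = ν univ ^ (p.toReal - 1) * ∫⁻ t, ∫⁻ x, ‖f x‖ₑ ^ p.toReal ∂volume ∂ν := by
            congr 1
            refine lintegral_congr fun t => ?_
            exact lintegral_sub_right_eq_self (fun x => ‖f x‖ₑ ^ p.toReal) (e * t)
        _ = _ := by
            rw [lintegral_const, mul_comm (lintegral _ _), ← mul_assoc]
            congr 1
            rcases eq_or_ne (ν univ) 0 with h | h
            · rw [h, mul_zero, ENNReal.zero_rpow_of_pos hpr0]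
            · nth_rewrite 2 [← ENNReal.rpow_one (ν univ)]
              rw [← ENNReal.rpow_add _ _ h (measure_ne_top _ _)]
              simp
    simp only [enorm_eq_self]
    calc _ ≤ (ν univ ^ p.toReal * ∫⁻ x, ‖f x‖ₑ ^ p.toReal) ^ (1 / p.toReal) :=
          ENNReal.rpow_le_rpow h3 (by positivity)
      _ = _ := by
          rw [ENNReal.mul_rpow_of_nonneg _ _ (by positivity), ← ENNReal.rpow_mul,
            mul_one_div_cancel hpr0.ne', ENNReal.rpow_one]

/-- The transpose of a one-sided integral operator with integrably dominated kernel. -/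
theorem exists_transpose_kernel {e : ℝ} (he : |e| = 1) {p : ℝ≥0∞} (hp : 1 ≤ p) {h : ℝ → ℝ}
    (hm : Measurable h) (hh : IntegrableOn h (Ioi 0)) {k : ℝ → ℝ → ℝ}
    (hk : Measurable (Function.uncurry k)) (hkh : ∀ x t, 0 < t → |k x t| ≤ h t)
    {f : ℝ → ℝ} (hf : MemLp f p volume) :
    ∃ w : ℝ → ℝ, MemLp w p volume ∧
      eLpNorm w p volume ≤ (∫⁻ t in Ioi 0, ‖h t‖ₑ) * eLpNorm f p volume ∧
      ∀ φ : ℝ → ℝ, Continuous φ → HasCompactSupport φ →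
        Integrable (fun x => f x * ∫ t in Ioi 0, k x t * φ (x + e * t)) ∧
        ∫ x, f x * ∫ t in Ioi 0, k x t * φ (x + e * t) = ∫ y, w y * φ y := by
  wlog hfs : StronglyMeasurable f generalizing f
  · have hfm := hf.1
    obtain ⟨w, hw, hwn, hwφ⟩ := this ((memLp_congr_ae hfm.ae_eq_mk).1 hf)
      hfm.stronglyMeasurable_mk
    refine ⟨w, hw, by rwa [eLpNorm_congr_ae hfm.ae_eq_mk], fun φ hφ hc => ?_⟩
    have : (fun x => f x * ∫ t in Ioi 0, k x t * φ (x + e * t)) =ᵐ[volume]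
        fun x => hfm.mk f x * ∫ t in Ioi 0, k x t * φ (x + e * t) := by
      filter_upwards [hfm.ae_eq_mk] with x hx
      rw [hx]
    rw [integrable_congr this, integral_congr_ae this]
    exact hwφ φ hφ hc
  have hfm := hfs.measurable
  -- With density `|h|`, the kernel bound becomes an average of translates of `|f|` against a finite
  -- measure.
  set ν : Measure ℝ := (volume.restrict (Ioi 0)).withDensity fun t => ‖h t‖ₑ with hν
  have hνu : ν univ = ∫⁻ t in Ioi 0, ‖h t‖ₑ := by
    rw [hν, withDensity_apply _ MeasurableSet.univ, Measure.restrict_univ]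
  have : IsFiniteMeasure ν := ⟨by rw [hνu]; exact hh.2⟩
  have hνv : ν ≪ volume :=
    (withDensity_absolutelyContinuous _ _).trans Measure.restrict_le_self.absolutelyContinuous
  set W : ℝ → ℝ≥0∞ := fun y => ∫⁻ t, ‖f (y - e * t)‖ₑ ∂ν with hW
  have hWeq : ∀ y, W y = ∫⁻ t in Ioi 0, ‖h t‖ₑ * ‖f (y - e * t)‖ₑ := by
    intro y
    simp only [hW, hν]
    have hg : Measurable fun t => ‖f (y - e * t)‖ₑ :=
      (hfm.comp (by fun_prop : Measurable fun t => y - e * t)).enorm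
    rw [lintegral_withDensity_eq_lintegral_mul _ hm.enorm hg]
    rfl
  have hWm : Measurable W := by
    refine Measurable.lintegral_prod_right' (f := fun z : ℝ × ℝ => ‖f (z.1 - e * z.2)‖ₑ) ?_
    exact (hfm.comp (by fun_prop)).enorm
  have hWn : eLpNorm W p volume ≤ ν univ * eLpNorm f p volume :=
    eLpNorm_lintegral_translate_le he hνv hp hfs
  have hΨm : Measurable fun z : ℝ × ℝ => k (z.2 - e * z.1) z.1 * f (z.2 - e * z.1) :=
    (hk.comp (by fun_prop : Measurable fun z : ℝ × ℝ => (z.2 - e * z.1, z.1))).mul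
      (hfm.comp (by fun_prop))
  set w : ℝ → ℝ := fun y => ∫ t in Ioi 0, k (y - e * t) t * f (y - e * t) with hw
  have hkW : ∀ y, ∫⁻ t in Ioi 0, ‖k (y - e * t) t * f (y - e * t)‖ₑ ≤ W y := by
    intro y
    rw [hWeq]
    refine setLIntegral_mono' measurableSet_Ioi fun t ht => ?_
    rw [enorm_mul]
    gcongr
    exact enorm_le_iff_norm_le.2 ((hkh _ t ht).trans (le_abs_self _))
  have hwW : ∀ y, ‖w y‖ₑ ≤ W y := fun y => (enorm_integral_le_lintegral_enorm _).trans (hkW y)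
  have hwm : AEStronglyMeasurable w volume := by
    have : StronglyMeasurable fun y => ∫ t in Ioi 0, (fun z : ℝ × ℝ =>
        k (z.2 - e * z.1) z.1 * f (z.2 - e * z.1)) (t, y) :=
      hΨm.stronglyMeasurable.integral_prod_left'
    exact this.aestronglyMeasurable
  have hwn : eLpNorm w p volume ≤ ν univ * eLpNorm f p volume :=
    (eLpNorm_mono_enorm (g := W) (fun y => by simpa using hwW y)).trans hWn
  have hfin : ν univ * eLpNorm f p volume < ∞ := ENNReal.mul_lt_top (measure_lt_top _ _) hf.2
  refine ⟨w, ⟨hwm, hwn.trans_lt hfin⟩, hνu ▸ hwn, fun φ hφ hc => ?_⟩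
  set Ψ : ℝ × ℝ → ℝ := fun z => k (z.2 - e * z.1) z.1 * f (z.2 - e * z.1) * φ z.2 with hΨ
  have hΨmeas : Measurable Ψ := hΨm.mul (hφ.measurable.comp measurable_snd)
  have hWφ : ∫⁻ y, W y * ‖φ y‖ₑ < ∞ := by
    have hWt : MemLp (fun y => (W y).toReal) p volume := by
      refine ⟨hWm.ennreal_toReal.aestronglyMeasurable, lt_of_le_of_lt ?_ (hWn.trans_lt hfin)⟩
      refine eLpNorm_mono_enorm fun y => ?_
      rw [Real.enorm_of_nonneg ENNReal.toReal_nonneg]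
      exact ENNReal.ofReal_toReal_le
    have hWfin : ∀ᵐ y, W y < ∞ := by
      have : eLpNorm W p volume < ∞ := hWn.trans_lt hfin
      rcases eq_or_ne p ∞ with rfl | hpt
      · rw [eLpNorm_exponent_top] at this
        filter_upwards [ae_le_eLpNormEssSup (f := W) (μ := volume)] with y hy
        exact lt_of_le_of_lt (by simpa using hy) this
      · have hp0 : p ≠ 0 := (zero_lt_one.trans_le hp).ne'
        have h2 := (eLpNorm_lt_top_iff_lintegral_rpow_enorm_lt_top hp0 hpt).1 this
        filter_upwards [ae_lt_top (hWm.enorm.pow_const _) h2.ne] with y hy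
        exact (ENNReal.rpow_lt_top_iff_of_pos (ENNReal.toReal_pos hp0 hpt)).1 (by simpa using hy)
    have hi : Integrable fun y => (W y).toReal * φ y := by
      have := (hWt.locallyIntegrable hp).integrable_smul_right_of_hasCompactSupport hφ hc
      simpa using this
    refine lt_of_le_of_lt (le_of_eq ?_) hi.2
    refine lintegral_congr_ae ?_
    filter_upwards [hWfin] with y hy
    rw [enorm_mul, Real.enorm_of_nonneg ENNReal.toReal_nonneg, ENNReal.ofReal_toReal hy.ne]
  have hΨi : Integrable Ψ ((volume.restrict (Ioi 0)).prod volume) := by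
    refine ⟨hΨmeas.aestronglyMeasurable, ?_⟩
    rw [HasFiniteIntegral, lintegral_prod_symm _ hΨmeas.enorm.aemeasurable]
    refine lt_of_le_of_lt (lintegral_mono fun y => ?_) hWφ
    simp only [hΨ, enorm_mul]
    rw [lintegral_mul_const' _ _ enorm_ne_top]
    gcongr
    simpa [enorm_mul] using hkW y
  -- The shear `(t, x) ↦ (t, x + e t)` preserves product measure; it carries integrability and the
  -- integral from the variables `(t, y)` to `(t, x)`.
  have hmp : MeasurePreserving (fun z : ℝ × ℝ => (z.1, z.2 + e * z.1))
      ((volume.restrict (Ioi 0)).prod volume) ((volume.restrict (Ioi 0)).prod volume) := by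
    refine (MeasurePreserving.id _).skew_product (g := fun t x => x + e * t) (by fun_prop) ?_
    exact ae_of_all _ fun t => (measurePreserving_add_right volume (e * t)).map_eq
  have hΨ2 : Integrable (fun z : ℝ × ℝ => k z.2 z.1 * f z.2 * φ (z.2 + e * z.1))
      ((volume.restrict (Ioi 0)).prod volume) := by
    have := hmp.integrable_comp_of_integrable hΨi
    simpa [hΨ, Function.comp_def] using this
  have hin : ∀ x, ∫ t in Ioi 0, k x t * f x * φ (x + e * t) =
      f x * ∫ t in Ioi 0, k x t * φ (x + e * t) := by
    intro x
    rw [← integral_const_mul]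
    congr 1 with t
    ring
  refine ⟨?_, ?_⟩
  · have := hΨ2.integral_prod_right
    simpa only [hin] using this
  · calc _ = ∫ x, ∫ t in Ioi 0, k x t * f x * φ (x + e * t) := by simp only [hin]
      _ = ∫ t in Ioi 0, ∫ x, k x t * f x * φ (x + e * t) :=
          (integral_integral_swap (f := fun t x => k x t * f x * φ (x + e * t)) hΨ2).symm
      _ = ∫ t in Ioi 0, ∫ y, Ψ (t, y) := by
          congr 1 with t
          refine Eq.trans ?_ (integral_add_right_eq_self (fun y => Ψ (t, y)) (e * t))
          simp [hΨ]
      _ = ∫ y, ∫ t in Ioi 0, Ψ (t, y) := integral_integral_swap (f := fun t y => Ψ (t, y)) hΨi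
      _ = _ := by
          congr 1 with y
          simp only [hΨ, hw]
          rw [integral_mul_const]

/-! ### Weak derivatives of integer order. -/

theorem integrable_mul_test {Ω : Set ℝ} {f g : ℝ → ℝ} (hf : LocallyIntegrableOn f Ω)
    (hg : IsTestFunction Ω g) : Integrable (fun x => f x * g x) := by
  have h1 : IntegrableOn (fun x => f x * g x) (tsupport g) :=
    (hf.integrableOn_compact_subset hg.2.2 hg.2.1).mul_continuousOn hg.continuous.continuousOn hg.2.1
  refine (integrableOn_iff_integrable_of_support_subset ?_).1 h1
  intro x hx
  by_contra hx'
  exact hx (by simp [image_eq_zero_of_notMem_tsupport hx'])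

theorem IsTestFunction.eq_zero {Ω : Set ℝ} {g : ℝ → ℝ} (hg : IsTestFunction Ω g) {x : ℝ}
    (hx : x ∉ Ω) : g x = 0 :=
  image_eq_zero_of_notMem_tsupport fun h => hx (hg.2.2 h)

theorem setIntegral_mul_test {Ω : Set ℝ} {g : ℝ → ℝ} (f : ℝ → ℝ) (hg : IsTestFunction Ω g) :
    ∫ x in Ω, f x * g x = ∫ x, f x * g x :=
  setIntegral_eq_integral_of_forall_compl_eq_zero fun x hx => by rw [hg.eq_zero hx, mul_zero]

theorem locallyIntegrableOn_mul_test {Ω : Set ℝ} {f g : ℝ → ℝ} (hf : LocallyIntegrableOn f Ω)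
    (hg : IsTestFunction Ω g) : LocallyIntegrableOn (fun x => g x * f x) univ := by
  have := (integrable_mul_test hf hg).locallyIntegrable
  simpa only [mul_comm (f _), locallyIntegrableOn_univ] using this

theorem IsWeakDeriv.one_of_succ {k : ℕ} {Ω : Set ℝ} {u v w : ℝ → ℝ} (hv : IsWeakDeriv k Ω u v)
    (hw : IsWeakDeriv (k + 1) Ω u w) : IsWeakDeriv 1 Ω v w := by
  refine ⟨hw.1, fun φ hφ => ?_⟩
  rw [hw.2 φ hφ, iteratedDeriv_one, hv.2 _ hφ.deriv, iteratedDeriv_succ']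
  ring

theorem IsWeakDeriv.succ_of_one {k : ℕ} {Ω : Set ℝ} {u v w : ℝ → ℝ} (hv : IsWeakDeriv k Ω u v)
    (hw : IsWeakDeriv 1 Ω v w) : IsWeakDeriv (k + 1) Ω u w := by
  refine ⟨hw.1, fun φ hφ => ?_⟩
  rw [hw.2 φ hφ, iteratedDeriv_one, hv.2 _ hφ.deriv, iteratedDeriv_succ']
  ring

theorem isWeakDeriv_zero {Ω : Set ℝ} {u : ℝ → ℝ} (hu : LocallyIntegrableOn u Ω) :
    IsWeakDeriv 0 Ω u u := ⟨hu, fun φ _ => by simp⟩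

theorem IsWeakDeriv.zero_zero (k : ℕ) (Ω : Set ℝ) : IsWeakDeriv k Ω (fun _ => 0) (fun _ => 0) :=
  ⟨(locallyIntegrable_zero (ε'' := ℝ)).locallyIntegrableOn Ω, fun φ _ => by simp⟩

theorem IsWeakDeriv.add {k : ℕ} {Ω : Set ℝ} {f g f' g' : ℝ → ℝ}
    (hfi : LocallyIntegrableOn f Ω) (hgi : LocallyIntegrableOn g Ω) (hf : IsWeakDeriv k Ω f f')
    (hg : IsWeakDeriv k Ω g g') :
    IsWeakDeriv k Ω (fun x => f x + g x) (fun x => f' x + g' x) := by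
  refine ⟨hf.1.add hg.1, fun φ hφ => ?_⟩
  simp only [add_mul]
  rw [integral_add (integrable_mul_test hf.1 hφ).integrableOn
      (integrable_mul_test hg.1 hφ).integrableOn,
    integral_add (integrable_mul_test hfi (hφ.iteratedDeriv k)).integrableOn
      (integrable_mul_test hgi (hφ.iteratedDeriv k)).integrableOn, hf.2 φ hφ, hg.2 φ hφ]
  ring

/-- For any test function `φ` on the line, `ψ φ` is a test function on `Ω`, so information on `Ω`
yields a weak derivative on all of `ℝ`. -/
theorem IsWeakDeriv.mul_test {Ω : Set ℝ} {ψ u u' : ℝ → ℝ} (hψ : IsTestFunction Ω ψ)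
    (hui : LocallyIntegrableOn u Ω) (hu : IsWeakDeriv 1 Ω u u') :
    IsWeakDeriv 1 univ (fun x => ψ x * u x) (fun x => ψ x * u' x + deriv ψ x * u x) := by
  refine ⟨(locallyIntegrableOn_mul_test hu.1 hψ).add (locallyIntegrableOn_mul_test hui hψ.deriv),
    fun φ hφ => ?_⟩
  have h1 : IsTestFunction Ω (fun x => ψ x * φ x) := hψ.mul_smooth hφ.1
  have h2 : IsTestFunction Ω (fun x => deriv ψ x * φ x) := hψ.deriv.mul_smooth hφ.1
  have h3 : IsTestFunction Ω (fun x => ψ x * deriv φ x) := hψ.mul_smooth hφ.deriv.1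
  have h4 := hu.2 _ h1
  have hd : deriv (fun x => ψ x * φ x) = fun x => deriv ψ x * φ x + ψ x * deriv φ x := by
    funext x
    exact ((hψ.hasDerivAt x).mul (hφ.hasDerivAt x)).deriv
  rw [iteratedDeriv_one, hd, setIntegral_mul_test u' h1,
    setIntegral_mul_test u (by rw [← hd]; exact h1.deriv)] at h4
  simp only [mul_add] at h4
  rw [integral_add (integrable_mul_test hui h2) (integrable_mul_test hui h3)] at h4
  rw [iteratedDeriv_one, Measure.restrict_univ]
  have e1 : ∀ x, (ψ x * u' x + deriv ψ x * u x) * φ x =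
      u' x * (ψ x * φ x) + u x * (deriv ψ x * φ x) := fun x => by ring
  have e2 : ∀ x, ψ x * u x * deriv φ x = u x * (ψ x * deriv φ x) := fun x => by ring
  simp only [e1, e2]
  rw [integral_add (integrable_mul_test hu.1 h1) (integrable_mul_test hui h2), h4]
  ring

/-- A smooth function may be used as a test function against a compactly supported function. -/
theorem IsWeakDeriv.integral_smooth {k : ℕ} {f g Φ : ℝ → ℝ} {R : ℝ} (h : IsWeakDeriv k univ f g)
    (hf : ∀ x, R < |x| → f x = 0) (hg : ∀ x, R < |x| → g x = 0) (hΦ : ContDiff ℝ ∞ω Φ) :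
    ∫ x, g x * Φ x = (-1) ^ k * ∫ x, f x * iteratedDeriv k Φ x := by
  -- A bump equal to `1` near every point of `[-R, R]`, so that `ζ Φ` and `Φ` have the same
  -- derivatives there; `|R|` keeps the radii positive for any `R`.
  let ζ : ContDiffBump (0 : ℝ) := ⟨|R| + 1, |R| + 2, by positivity, by linarith⟩
  have hζ1 : ∀ x, |x| ≤ R → ζ =ᶠ[𝓝 x] 1 := fun x hx =>
    ζ.eventuallyEq_one_of_mem_ball (by
      rw [Metric.mem_ball, dist_zero_right, Real.norm_eq_abs]
      have : R ≤ |R| := le_abs_self R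
      show |x| < |R| + 1
      linarith)
  have ht : IsTestFunction univ (fun x => ζ x * Φ x) :=
    IsTestFunction.mul_smooth ⟨ζ.contDiff, ζ.hasCompactSupport, subset_univ _⟩ hΦ
  have h1 := h.2 _ ht
  rw [Measure.restrict_univ] at h1
  refine Eq.trans (integral_congr_ae (ae_of_all _ fun x => ?_)) (h1.trans ?_)
  · rcases lt_or_ge R |x| with hx | hx
    · simp [hg x hx]
    · simp [(hζ1 x hx).eq_of_nhds]
  · congr 1
    refine integral_congr_ae (ae_of_all _ fun x => ?_)
    rcases lt_or_ge R |x| with hx | hx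
    · simp [hf x hx]
    · have : (fun x => ζ x * Φ x) =ᶠ[𝓝 x] Φ := by
        filter_upwards [hζ1 x hx] with y hy
        simp [hy]
      simp only [this.iteratedDeriv_eq k]

/-! ### Quantitative `L^p` bounds and the Leibniz rule. -/

/-- `f` is measurable with `L^p`-norm at most `A`. -/
def LpBound (p : ℝ≥0∞) (μ : Measure ℝ) (A : ℝ≥0) (f : ℝ → ℝ) : Prop :=
  AEStronglyMeasurable f μ ∧ eLpNorm f p μ ≤ A

theorem LpBound.memLp {p : ℝ≥0∞} {μ : Measure ℝ} {A : ℝ≥0} {f : ℝ → ℝ} (h : LpBound p μ A f) :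
    MemLp f p μ := ⟨h.1, h.2.trans_lt ENNReal.coe_lt_top⟩

theorem LpBound.add {p : ℝ≥0∞} (hp : 1 ≤ p) {μ : Measure ℝ} {A B : ℝ≥0} {f g : ℝ → ℝ}
    (hf : LpBound p μ A f) (hg : LpBound p μ B g) : LpBound p μ (A + B) (fun x => f x + g x) :=
  ⟨hf.1.add hg.1, (eLpNorm_add_le hf.1 hg.1 hp).trans (by
    rw [ENNReal.coe_add]; exact add_le_add hf.2 hg.2)⟩

theorem LpBound.mono {p : ℝ≥0∞} {μ : Measure ℝ} {A B : ℝ≥0} {f : ℝ → ℝ}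
    (hf : LpBound p μ A f) (h : A ≤ B) : LpBound p μ B f :=
  ⟨hf.1, hf.2.trans (by exact_mod_cast h)⟩

theorem LpBound.mul_bdd {p : ℝ≥0∞} {μ : Measure ℝ} {A C : ℝ≥0} {f g : ℝ → ℝ}
    (hf : LpBound p μ A f) (hg : AEStronglyMeasurable g μ) (hC : ∀ x, |g x| ≤ C) :
    LpBound p μ (C * A) (fun x => g x * f x) := by
  refine ⟨hg.mul hf.1, ?_⟩
  have := eLpNorm_le_nnreal_smul_eLpNorm_of_ae_le_mul (f := fun x => g x * f x) (g := f) (μ := μ)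
    (c := C) (ae_of_all _ fun x => by
      rw [← NNReal.coe_le_coe]
      push_cast
      rw [norm_mul]
      exact mul_le_mul_of_nonneg_right (hC x) (norm_nonneg _)) p
  refine this.trans ?_
  rw [ENNReal.coe_mul, ENNReal.smul_def, smul_eq_mul]
  gcongr
  exact hf.2

theorem LpBound.const_mul {p : ℝ≥0∞} {μ : Measure ℝ} {A : ℝ≥0} {f : ℝ → ℝ}
    (hf : LpBound p μ A f) (c : ℝ) : LpBound p μ (‖c‖₊ * A) (fun x => c * f x) :=
  hf.mul_bdd aestronglyMeasurable_const fun _ => le_rfl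

theorem LpBound.zero {p : ℝ≥0∞} {μ : Measure ℝ} {A : ℝ≥0} : LpBound p μ A (fun _ => 0) :=
  ⟨aestronglyMeasurable_const, by simp⟩

/-- Functions bounded on `Ω` and vanishing off `Ω` are bounded on the line. -/
theorem LpBound.of_restrict {p : ℝ≥0∞} {Ω : Set ℝ} (hΩ : MeasurableSet Ω) {A : ℝ≥0} {f : ℝ → ℝ}
    (hf : LpBound p (volume.restrict Ω) A f) (h0 : ∀ x, x ∉ Ω → f x = 0) :
    LpBound p volume A f := by
  have h : Ω.indicator f = f := by
    funext x
    by_cases hx : x ∈ Ω <;> simp [hx, h0]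
  refine ⟨?_, ?_⟩
  · rw [← h, aestronglyMeasurable_indicator_iff hΩ]
    exact hf.1
  · rw [← h, eLpNorm_indicator_eq_eLpNorm_restrict hΩ]
    exact hf.2

theorem LpBound.locallyIntegrableOn {p : ℝ≥0∞} (hp : 1 ≤ p) {Ω : Set ℝ} {A : ℝ≥0} {f : ℝ → ℝ}
    (hf : LpBound p (volume.restrict Ω) A f) : LocallyIntegrableOn f Ω :=
  locallyIntegrableOn_of_locallyIntegrable_restrict (hf.memLp.locallyIntegrable hp)

theorem LpBound.mul_test {p : ℝ≥0∞} {Ω : Set ℝ} (hΩ : MeasurableSet Ω) {ψ : ℝ → ℝ}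
    (hψ : IsTestFunction Ω ψ) :
    ∃ C : ℝ≥0, ∀ (f : ℝ → ℝ) (A : ℝ≥0), LpBound p (volume.restrict Ω) A f →
      LpBound p volume (C * A) (fun x => ψ x * f x) := by
  obtain ⟨C, hC, hb⟩ := exists_bound hψ.continuous hψ.2.1
  refine ⟨⟨C, hC⟩, fun f A hf => ?_⟩
  refine LpBound.of_restrict hΩ (hf.mul_bdd hψ.continuous.aestronglyMeasurable hb) fun x hx => ?_
  rw [hψ.eq_zero hx, zero_mul]

/-- A function with its weak derivatives up to order `m`, all of `L^p`-norm at most `A`. -/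
def SobFamily (m : ℕ) (p : ℝ≥0∞) (Ω : Set ℝ) (A : ℝ≥0) (u : ℕ → ℝ → ℝ) : Prop :=
  (∀ j ≤ m, LpBound p (volume.restrict Ω) A (u j)) ∧ ∀ j < m, IsWeakDeriv 1 Ω (u j) (u (j + 1))

theorem SobFamily.shift {m : ℕ} {p : ℝ≥0∞} {Ω : Set ℝ} {A : ℝ≥0} {u : ℕ → ℝ → ℝ}
    (h : SobFamily (m + 1) p Ω A u) : SobFamily m p Ω A (fun j => u (j + 1)) :=
  ⟨fun j hj => h.1 _ (by lia), fun j hj => h.2 _ (by lia)⟩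

theorem SobFamily.mono {m n : ℕ} {p : ℝ≥0∞} {Ω : Set ℝ} {A : ℝ≥0} {u : ℕ → ℝ → ℝ}
    (h : SobFamily m p Ω A u) (hn : n ≤ m) : SobFamily n p Ω A u :=
  ⟨fun j hj => h.1 _ (by lia), fun j hj => h.2 _ (by lia)⟩

theorem SobFamily.isWeakDeriv {m : ℕ} {p : ℝ≥0∞} (hp : 1 ≤ p) {Ω : Set ℝ} {A : ℝ≥0}
    {u : ℕ → ℝ → ℝ} (h : SobFamily m p Ω A u) {k : ℕ} (hk : k ≤ m) :
    IsWeakDeriv k Ω (u 0) (u k) := by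
  induction k with
  | zero => exact isWeakDeriv_zero ((h.1 0 hk).locallyIntegrableOn hp)
  | succ k ih => exact (ih (by lia)).succ_of_one (h.2 k (by lia))

/-- The `k`-th derivative of `ψ u` by the Leibniz rule, from the family of derivatives of `u`. -/
noncomputable def leibniz : ℕ → (ℝ → ℝ) → (ℕ → ℝ → ℝ) → ℝ → ℝ
  | 0, ψ, u => fun x => ψ x * u 0 x
  | k + 1, ψ, u => fun x => leibniz k ψ (fun j => u (j + 1)) x + leibniz k (deriv ψ) u x

/-- The terms of `leibniz k ψ u` other than `ψ * u k`. -/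
noncomputable def leibnizRem : ℕ → (ℝ → ℝ) → (ℕ → ℝ → ℝ) → ℝ → ℝ
  | 0, _, _ => fun _ => 0
  | k + 1, ψ, u => fun x => leibnizRem k ψ (fun j => u (j + 1)) x + leibniz k (deriv ψ) u x

/-- The weak derivative of `leibnizRem k ψ u`. -/
noncomputable def leibnizRemDeriv : ℕ → (ℝ → ℝ) → (ℕ → ℝ → ℝ) → ℝ → ℝ
  | 0, _, _ => fun _ => 0
  | k + 1, ψ, u => fun x =>
      leibnizRemDeriv k ψ (fun j => u (j + 1)) x + leibniz (k + 1) (deriv ψ) u x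

/-- The remainder involves only `u j` with `j < k`, so it can be differentiated once more without
exceeding the regularity of `u`. -/
theorem leibniz_eq (k : ℕ) (ψ : ℝ → ℝ) (u : ℕ → ℝ → ℝ) (x : ℝ) :
    leibniz k ψ u x = ψ x * u k x + leibnizRem k ψ u x := by
  induction k generalizing ψ u with
  | zero => simp [leibniz, leibnizRem]
  | succ k ih => simp only [leibniz, leibnizRem, ih ψ]; ring

theorem leibniz_eq_zero (k : ℕ) {ψ : ℝ → ℝ} (u : ℕ → ℝ → ℝ) {x : ℝ} (hx : x ∉ tsupport ψ) :
    leibniz k ψ u x = 0 := by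
  induction k generalizing ψ u with
  | zero => simp [leibniz, image_eq_zero_of_notMem_tsupport hx]
  | succ k ih => simp only [leibniz, ih _ hx, ih _ fun h => hx (tsupport_deriv_subset h), add_zero]

section
variable {p : ℝ≥0∞} (hp : 1 ≤ p) {Ω : Set ℝ} (hΩ : MeasurableSet Ω)
include hp hΩ

theorem leibniz_lpBound (k : ℕ) {ψ : ℝ → ℝ} (hψ : IsTestFunction Ω ψ) :
    ∃ C : ℝ≥0, ∀ (u : ℕ → ℝ → ℝ) (A : ℝ≥0), SobFamily k p Ω A u →
      LpBound p volume (C * A) (leibniz k ψ u) := by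
  induction k generalizing ψ with
  | zero =>
    obtain ⟨C, hC⟩ := LpBound.mul_test (p := p) hΩ hψ
    exact ⟨C, fun u A hu => hC _ _ (hu.1 0 le_rfl)⟩
  | succ k ih =>
    obtain ⟨C, hC⟩ := ih hψ
    obtain ⟨D, hD⟩ := ih hψ.deriv
    refine ⟨C + D, fun u A hu => ?_⟩
    rw [add_mul]
    exact (hC _ A hu.shift).add hp (hD _ A (hu.mono (by lia)))

theorem leibnizRem_lpBound (k : ℕ) {ψ : ℝ → ℝ} (hψ : IsTestFunction Ω ψ) :
    ∃ C : ℝ≥0, ∀ (u : ℕ → ℝ → ℝ) (A : ℝ≥0), SobFamily k p Ω A u →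
      LpBound p volume (C * A) (leibnizRem k ψ u) := by
  induction k generalizing ψ with
  | zero => exact ⟨0, fun u A _ => LpBound.zero⟩
  | succ k ih =>
    obtain ⟨C, hC⟩ := ih hψ
    obtain ⟨D, hD⟩ := leibniz_lpBound hp hΩ k hψ.deriv
    refine ⟨C + D, fun u A hu => ?_⟩
    rw [add_mul]
    exact (hC _ A hu.shift).add hp (hD _ A (hu.mono (by lia)))

theorem leibnizRemDeriv_lpBound (k : ℕ) {ψ : ℝ → ℝ} (hψ : IsTestFunction Ω ψ) :
    ∃ C : ℝ≥0, ∀ (u : ℕ → ℝ → ℝ) (A : ℝ≥0), SobFamily k p Ω A u →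
      LpBound p volume (C * A) (leibnizRemDeriv k ψ u) := by
  induction k generalizing ψ with
  | zero => exact ⟨0, fun u A _ => LpBound.zero⟩
  | succ k ih =>
    obtain ⟨C, hC⟩ := ih hψ
    obtain ⟨D, hD⟩ := leibniz_lpBound hp hΩ (k + 1) hψ.deriv
    refine ⟨C + D, fun u A hu => ?_⟩
    rw [add_mul]
    exact (hC _ A hu.shift).add hp (hD _ A hu)

theorem leibniz_locallyIntegrableOn {k : ℕ} {ψ : ℝ → ℝ} (hψ : IsTestFunction Ω ψ)
    {u : ℕ → ℝ → ℝ} {A : ℝ≥0} (hu : SobFamily k p Ω A u) :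
    LocallyIntegrableOn (leibniz k ψ u) univ := by
  obtain ⟨C, hC⟩ := leibniz_lpBound hp hΩ k hψ
  exact LpBound.locallyIntegrableOn (p := p) hp (by simpa using hC u A hu)

theorem leibniz_isWeakDeriv {k : ℕ} {ψ : ℝ → ℝ} (hψ : IsTestFunction Ω ψ) {u : ℕ → ℝ → ℝ}
    {A : ℝ≥0} (hu : SobFamily (k + 1) p Ω A u) :
    IsWeakDeriv 1 univ (leibniz k ψ u) (leibniz (k + 1) ψ u) := by
  induction k generalizing ψ u with
  | zero =>
    exact IsWeakDeriv.mul_test hψ ((hu.1 0 (by lia)).locallyIntegrableOn hp) (hu.2 0 (by lia))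
  | succ k ih =>
    exact IsWeakDeriv.add (leibniz_locallyIntegrableOn hp hΩ hψ (hu.shift.mono (by lia)))
      (leibniz_locallyIntegrableOn hp hΩ hψ.deriv (hu.mono (by lia))) (ih hψ hu.shift)
      (ih hψ.deriv (hu.mono (by lia)))

theorem leibnizRem_isWeakDeriv {k : ℕ} {ψ : ℝ → ℝ} (hψ : IsTestFunction Ω ψ) {u : ℕ → ℝ → ℝ}
    {A : ℝ≥0} (hu : SobFamily k p Ω A u) :
    IsWeakDeriv 1 univ (leibnizRem k ψ u) (leibnizRemDeriv k ψ u) := by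
  induction k generalizing ψ u with
  | zero => exact IsWeakDeriv.zero_zero 1 univ
  | succ k ih =>
    obtain ⟨C, hC⟩ := leibnizRem_lpBound hp hΩ k hψ
    exact IsWeakDeriv.add
      (LpBound.locallyIntegrableOn (p := p) hp (by simpa using hC _ A hu.shift))
      (leibniz_locallyIntegrableOn hp hΩ hψ.deriv (hu.mono (by lia))) (ih hψ hu.shift)
      (leibniz_isWeakDeriv hp hΩ hψ.deriv hu)

/-- Multiplication by a test function maps `W^{m,p}(Ω)` to `W^{m,p}(ℝ)`. -/
theorem leibniz_sobFamily (m : ℕ) {ψ : ℝ → ℝ} (hψ : IsTestFunction Ω ψ) :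
    ∃ C : ℝ≥0, ∀ (u : ℕ → ℝ → ℝ) (A : ℝ≥0), SobFamily m p Ω A u →
      SobFamily m p univ (C * A) (fun k => leibniz k ψ u) := by
  choose C hC using fun k => leibniz_lpBound hp hΩ k hψ
  refine ⟨∑ k ∈ Finset.range (m + 1), C k, fun u A hu => ⟨fun j hj => ?_, fun j hj => ?_⟩⟩
  · rw [Measure.restrict_univ]
    refine (hC j u A (hu.mono hj)).mono ?_
    gcongr
    exact Finset.single_le_sum (f := C) (fun _ _ => zero_le) (Finset.mem_range.2 (by lia))
  · exact leibniz_isWeakDeriv hp hΩ hψ (hu.mono hj)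

end

/-! ### Truncated power kernels and integration by parts. -/

/-- The constant is `∫ |h|`, chosen before `f`; this uniformity makes the final constant independent
of `u`. -/
theorem exists_transpose_lpBound {e : ℝ} (he : |e| = 1) {p : ℝ≥0∞} (hp : 1 ≤ p) {h : ℝ → ℝ}
    (hm : Measurable h) (hh : IntegrableOn h (Ioi 0)) {k : ℝ → ℝ → ℝ}
    (hk : Measurable (Function.uncurry k)) (hkh : ∀ x t, 0 < t → |k x t| ≤ h t) :
    ∃ C : ℝ≥0, ∀ (f : ℝ → ℝ) (A : ℝ≥0), LpBound p volume A f →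
      ∃ w : ℝ → ℝ, LpBound p volume (C * A) w ∧
        ∀ φ : ℝ → ℝ, IsTestFunction univ φ →
          Integrable (fun x => f x * ∫ t in Ioi 0, k x t * φ (x + e * t)) ∧
          ∫ x, f x * ∫ t in Ioi 0, k x t * φ (x + e * t) = ∫ y, w y * φ y := by
  refine ⟨(∫⁻ t in Ioi 0, ‖h t‖ₑ).toNNReal, fun f A hf => ?_⟩
  obtain ⟨w, hw, hwn, hwφ⟩ := exists_transpose_kernel he hp hm hh hk hkh hf.memLp
  refine ⟨w, ⟨hw.1, hwn.trans ?_⟩, fun φ hφ => hwφ φ hφ.continuous hφ.2.1⟩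
  rw [ENNReal.coe_mul, ENNReal.coe_toNNReal (LT.lt.ne hh.2)]
  gcongr
  exact hf.2

/-- The power `t ^ (-γ)` cut off to `t > δ`. -/
noncomputable def powFar (γ δ : ℝ) : ℝ → ℝ := (Ioi δ).indicator fun t => t ^ (-γ)

/-- The power `t ^ (-γ)` cut off to `t ≤ 1`. -/
noncomputable def powNear (γ : ℝ) : ℝ → ℝ := (Iic 1).indicator fun t => t ^ (-γ)

theorem measurable_powFar (γ δ : ℝ) : Measurable (powFar γ δ) :=
  (by fun_prop : Measurable fun t : ℝ => t ^ (-γ)).indicator measurableSet_Ioi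

theorem measurable_powNear (γ : ℝ) : Measurable (powNear γ) :=
  (by fun_prop : Measurable fun t : ℝ => t ^ (-γ)).indicator measurableSet_Iic

theorem powFar_nonneg {γ δ : ℝ} (hδ : 0 < δ) (t : ℝ) : 0 ≤ powFar γ δ t :=
  indicator_nonneg (fun _ ht => Real.rpow_nonneg (hδ.trans ht).le _) _

theorem powNear_nonneg {γ t : ℝ} (ht : 0 < t) : 0 ≤ powNear γ t :=
  indicator_apply_nonneg fun _ => Real.rpow_nonneg ht.le _

theorem integrableOn_powFar_Ioc {γ δ : ℝ} (hγ : 0 ≤ γ) (hδ : 0 < δ) (R : ℝ) :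
    IntegrableOn (powFar γ δ) (Ioc 0 R) := by
  refine Measure.integrableOn_of_bounded (M := δ ^ (-γ)) (by simp)
    (measurable_powFar γ δ).aestronglyMeasurable (ae_of_all _ fun t => ?_)
  rw [Real.norm_of_nonneg (powFar_nonneg hδ t)]
  by_cases ht : t ∈ Ioi δ
  · rw [powFar, indicator_of_mem ht]
    exact Real.rpow_le_rpow_of_nonpos hδ (le_of_lt ht) (by linarith)
  · rw [powFar, indicator_of_notMem ht]
    positivity

theorem integrableOn_powFar {γ δ : ℝ} (hγ : 1 < γ) (hδ : 0 < δ) :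
    IntegrableOn (powFar γ δ) (Ioi 0) :=
  (((integrableOn_Ioi_rpow_of_lt (by linarith : -γ < -1) hδ).integrable_indicator
    measurableSet_Ioi).integrableOn)

theorem integrableOn_powNear {γ : ℝ} (hγ : γ < 1) : IntegrableOn (powNear γ) (Ioi 0) := by
  rw [IntegrableOn, powNear, integrable_indicator_iff measurableSet_Iic, IntegrableOn,
    Measure.restrict_restrict measurableSet_Iic, inter_comm]
  exact integrableOn_rpow_Ioc (by linarith) 1

theorem powNear_add_powFar (γ t : ℝ) : powNear γ t + powFar γ 1 t = t ^ (-γ) := by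
  rcases le_or_gt t 1 with h | h
  · simp [powNear, powFar, h]
  · simp [powNear, powFar, h]

theorem mul_self_of_abs_eq_one {e : ℝ} (he : |e| = 1) : e * e = 1 := by
  rw [← abs_mul_abs_self, he, one_mul]

theorem tendsto_far_zero {e : ℝ} (he : |e| = 1) {η : ℝ → ℝ} (hη : HasCompactSupport η)
    (u : ℝ → ℝ) (x : ℝ) : Tendsto (u * fun t => η (x + e * t)) atTop (𝓝 0) := by
  obtain ⟨R, _, h0⟩ := exists_radius hη
  refine tendsto_const_nhds.congr' ?_
  filter_upwards [eventually_gt_atTop (|x| + R)] with t ht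
  simp [oneSided_eq_zero_of_far he h0 ht]

theorem hasDerivAt_comp_dir {Ω : Set ℝ} {η : ℝ → ℝ} (hη : IsTestFunction Ω η) (e x t : ℝ) :
    HasDerivAt (fun t => η (x + e * t)) (e * deriv η (x + e * t)) t := by
  have h1 : HasDerivAt (fun t => x + e * t) e t := by
    simpa using ((hasDerivAt_id t).const_mul e).const_add x
  simpa [mul_comm, Function.comp_def] using (hη.hasDerivAt (x + e * t)).comp t h1

/-- Integration by parts away from the singularity. -/
theorem oneSided_powFar_deriv {e : ℝ} (he : |e| = 1) {γ δ : ℝ} (hγ : 0 ≤ γ) (hδ : 0 < δ)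
    {η : ℝ → ℝ} (hη : IsTestFunction univ η) (x : ℝ) :
    oneSided e (powFar γ δ) (deriv η) x =
      -e * δ ^ (-γ) * η (x + e * δ) + e * γ * oneSided e (powFar (γ + 1) δ) η x := by
  have hind : ∀ (γ : ℝ) (g : ℝ → ℝ), (fun t => powFar γ δ t * g (x + e * t)) =
      (Ioi δ).indicator fun t => t ^ (-γ) * g (x + e * t) := by
    intro γ g
    funext t
    by_cases ht : t ∈ Ioi δ <;> simp only [powFar, ht, indicator_of_mem, indicator_of_notMem,
      not_false_eq_true, zero_mul]
  have hsub : Ioi δ ∩ Ioi 0 = Ioi δ := inter_eq_left.2 (Ioi_subset_Ioi hδ.le)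
  have hone : ∀ (γ : ℝ) (g : ℝ → ℝ), oneSided e (powFar γ δ) g x =
      ∫ t in Ioi δ, t ^ (-γ) * g (x + e * t) := by
    intro γ g
    rw [oneSided, hind, integral_indicator measurableSet_Ioi,
      Measure.restrict_restrict measurableSet_Ioi, hsub]
  have hint : ∀ (γ : ℝ) (g : ℝ → ℝ), 0 ≤ γ → IsTestFunction univ g →
      IntegrableOn (fun t => t ^ (-γ) * g (x + e * t)) (Ioi δ) := by
    intro γ g hγ hg
    have := integrableOn_oneSided he (integrableOn_powFar_Ioc hγ hδ) hg.continuous hg.2.1 x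
    rwa [hind, IntegrableOn, integrable_indicator_iff measurableSet_Ioi, IntegrableOn,
      Measure.restrict_restrict measurableSet_Ioi, hsub] at this
  have hu : ∀ t ∈ Ioi δ, HasDerivAt (fun t : ℝ => t ^ (-γ)) (-γ * t ^ (-(γ + 1))) t := by
    intro t ht
    have := Real.hasDerivAt_rpow_const (p := -γ) (Or.inl (hδ.trans ht).ne')
    rwa [show -γ - 1 = -(γ + 1) by ring] at this
  have key := integral_Ioi_mul_deriv_eq_deriv_mul (a := δ) (a' := δ ^ (-γ) * η (x + e * δ))
    (b' := 0) hu (fun t _ => hasDerivAt_comp_dir hη e x t)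
    (by
      have := (hint γ _ hγ hη.deriv).const_mul e
      refine IntegrableOn.congr_fun this (fun t _ => ?_) measurableSet_Ioi
      simp only [Pi.mul_apply]; ring)
    (by
      have := (hint (γ + 1) _ (by linarith) hη).const_mul (-γ)
      refine IntegrableOn.congr_fun this (fun t _ => ?_) measurableSet_Ioi
      simp only [Pi.mul_apply]; ring)
    (by
      refine tendsto_nhdsWithin_of_tendsto_nhds (ContinuousAt.tendsto ?_)
      exact (Real.continuousAt_rpow_const _ _ (Or.inl hδ.ne')).mul
        (hasDerivAt_comp_dir hη e x δ).continuousAt)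
    (tendsto_far_zero he hη.2.1 _ x)
  have e1 : ∀ t : ℝ, t ^ (-γ) * (e * deriv η (x + e * t)) = e * (t ^ (-γ) * deriv η (x + e * t)) :=
    fun t => by ring
  have e2 : ∀ t : ℝ, -γ * t ^ (-(γ + 1)) * η (x + e * t) =
      -γ * (t ^ (-(γ + 1)) * η (x + e * t)) := fun t => by ring
  simp only [e1, e2, integral_const_mul] at key
  rw [hone, hone]
  -- The chain rule contributes a factor `e` to `key`; multiplying by `e` removes it, since `e² =
  -- 1`.
  linear_combination e * key - (∫ t in Ioi δ, t ^ (-γ) * deriv η (x + e * t)) *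
    (mul_self_of_abs_eq_one he)

/-- Off the support of `η`, the operator applied to a derivative has a regular kernel. -/
theorem exists_oneSided_powFar_iteratedDeriv {e : ℝ} (he : |e| = 1) {δ : ℝ} (hδ : 0 < δ)
    (n : ℕ) {γ : ℝ} (hγ : 0 ≤ γ) :
    ∃ d : ℝ, ∀ (x : ℝ) (η : ℝ → ℝ), IsTestFunction univ η →
      (∀ t, |t| < 2 * δ → η (x + t) = 0) →
      oneSided e (powFar γ δ) (iteratedDeriv n η) x = d * oneSided e (powFar (γ + n) δ) η x := by
  induction n with
  | zero => exact ⟨1, fun x η _ _ => by simp⟩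
  | succ n ih =>
    obtain ⟨d, hd⟩ := ih
    -- Each integration by parts contributes `e (γ + n)`. The boundary term sits at distance `δ < 2
    -- δ` from `x`, where `η` vanishes.
    refine ⟨d * (e * (γ + n)), fun x η hη h0 => ?_⟩
    rw [iteratedDeriv_succ', hd x _ hη.deriv (fun t ht => ?_),
      oneSided_powFar_deriv he (by positivity) hδ hη, h0 (e * δ)]
    · push_cast
      rw [add_assoc γ]
      ring
    · rw [abs_mul, he, abs_of_pos hδ]
      linarith
    · have : η =ᶠ[𝓝 (x + t)] fun _ => 0 := by
        have hs : ∀ᶠ s in 𝓝 (x + t), |s - x| < 2 * δ := by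
          refine (by fun_prop : Continuous fun s => |s - x|).continuousAt.eventually_lt_const ?_
          simpa using ht
        filter_upwards [hs] with s hs
        simpa using h0 _ hs
      rw [this.deriv_eq]
      simp

theorem iteratedDeriv_eq_zero_of_near {η : ℝ → ℝ} {x ρ : ℝ} (h0 : ∀ t, |t| < ρ → η (x + t) = 0)
    (n : ℕ) {t : ℝ} (ht : |t| < ρ) : iteratedDeriv n η (x + t) = 0 := by
  have : η =ᶠ[𝓝 (x + t)] fun _ => 0 := by
    have hs : ∀ᶠ s in 𝓝 (x + t), |s - x| < ρ := by
      refine (by fun_prop : Continuous fun s => |s - x|).continuousAt.eventually_lt_const ?_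
      simpa using ht
    filter_upwards [hs] with s hs
    simpa using h0 _ hs
  rw [this.iteratedDeriv_eq n]
  simp

/-- Integration by parts at the singularity. -/
theorem integral_rpow_mul_deriv {σ : ℝ} (hσ1 : σ < 1) {G G' : ℝ → ℝ} {R L : ℝ}
    (hG : ∀ t, HasDerivAt G (G' t) t) (hR : ∀ t, R < t → G t = 0)
    (hL : ∀ t, 0 < t → |G t| ≤ L * t)
    (hi : IntegrableOn (fun t => t ^ (-σ) * G' t) (Ioi 0)) :
    ∫ t in Ioi 0, t ^ (-σ) * G' t = σ * ∫ t in Ioi 0, t ^ (-(σ + 1)) * G t := by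
  have hGc : Continuous G := continuous_iff_continuousAt.2 fun t => (hG t).continuousAt
  have hpow : ∀ t : ℝ, 0 < t → t ^ (-(σ + 1)) * t = t ^ (-σ) := fun t ht => by
    nth_rewrite 2 [← Real.rpow_one t]
    rw [← Real.rpow_add ht]
    ring_nf
  have hu : ∀ t ∈ Ioi (0 : ℝ), HasDerivAt (fun t : ℝ => t ^ (-σ)) (-σ * t ^ (-(σ + 1))) t := by
    intro t ht
    have := Real.hasDerivAt_rpow_const (p := -σ) (Or.inl (mem_Ioi.1 ht).ne')
    rwa [show -σ - 1 = -(σ + 1) by ring] at this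
  -- `|G t| ≤ L t` improves `t^(-(σ+1)) G` to order `t^(-σ)` at the origin, and likewise makes the
  -- boundary term there of order `t^(1-σ)`.
  have hi2 : IntegrableOn (fun t => t ^ (-(σ + 1)) * G t) (Ioi 0) := by
    have h1 : IntegrableOn (fun t => t ^ (-(σ + 1)) * G t) (Ioc 0 R) := by
      refine Integrable.mono' ((integrableOn_rpow_Ioc (by linarith : -1 < -σ) R).const_mul L)
        ((by fun_prop : Measurable fun t : ℝ => t ^ (-(σ + 1))).mul
          hGc.measurable).aestronglyMeasurable ?_
      filter_upwards [ae_restrict_mem measurableSet_Ioc] with t ht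
      have h2 : 0 ≤ t ^ (-(σ + 1)) := Real.rpow_nonneg ht.1.le _
      rw [norm_mul, Real.norm_of_nonneg h2, ← hpow t ht.1]
      calc _ ≤ t ^ (-(σ + 1)) * (L * t) := mul_le_mul_of_nonneg_left (hL t ht.1) h2
        _ = _ := by ring
    refine h1.of_forall_sdiff_eq_zero measurableSet_Ioi ?_
    rintro t ⟨ht, ht'⟩
    rw [hR t (not_le.1 fun h => ht' ⟨ht, h⟩), mul_zero]
  have key := integral_Ioi_mul_deriv_eq_deriv_mul (a := 0) (a' := 0) (b' := 0) hu
    (fun t _ => hG t) hi (by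
      refine IntegrableOn.congr_fun (hi2.const_mul (-σ)) (fun t _ => ?_) measurableSet_Ioi
      simp only [Pi.mul_apply]; ring)
    (by
      have h1 : Tendsto (fun t : ℝ => L * t ^ (1 - σ)) (𝓝[>] 0) (𝓝 0) := by
        have := ((Real.continuousAt_rpow_const 0 (1 - σ) (Or.inr (by linarith))).tendsto).const_mul L
        rw [Real.zero_rpow (by linarith), mul_zero] at this
        exact tendsto_nhdsWithin_of_tendsto_nhds this
      refine squeeze_zero_norm' ?_ h1
      filter_upwards [self_mem_nhdsWithin] with t (ht : 0 < t)
      have h2 : 0 ≤ t ^ (-σ) := Real.rpow_nonneg ht.le _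
      rw [Pi.mul_apply, norm_mul, Real.norm_of_nonneg h2]
      calc _ ≤ t ^ (-σ) * (L * t) := mul_le_mul_of_nonneg_left (hL t ht) h2
        _ = L * (t ^ (-σ) * t ^ (1 : ℝ)) := by rw [Real.rpow_one]; ring
        _ = _ := by rw [← Real.rpow_add ht]; ring_nf)
    (by
      refine tendsto_const_nhds.congr' ?_
      filter_upwards [eventually_gt_atTop R] with t ht
      simp [hR t ht])
  rw [key, ← integral_const_mul, sub_zero, zero_sub, ← integral_neg]
  congr 1 with t
  ring

/-- The commutator of a fractional derivative with multiplication by a test function has a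
weakly singular kernel. -/
theorem oneSided_commutator {e : ℝ} (he : |e| = 1) {σ : ℝ} (hσ1 : σ < 1)
    {ψ φ : ℝ → ℝ} (hψ : IsTestFunction univ ψ) (hφ : IsTestFunction univ φ) (x : ℝ) :
    ψ x * oneSided e (fun t => t ^ (-σ)) (deriv φ) x -
      oneSided e (fun t => t ^ (-σ)) (deriv fun y => ψ y * φ y) x =
    ∫ t in Ioi 0, (e * σ * t ^ (-(σ + 1)) * (ψ x - ψ (x + e * t))) * φ (x + e * t) := by
  have hκ := integrableOn_rpow_Ioc (by linarith : -1 < -σ)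
  have hψφ : IsTestFunction univ fun y => ψ y * φ y := hψ.mul_smooth hφ.1
  have hd : ∀ y, deriv (fun y => ψ y * φ y) y = deriv ψ y * φ y + ψ y * deriv φ y := fun y =>
    ((hψ.hasDerivAt y).mul (hφ.hasDerivAt y)).deriv
  obtain ⟨R, _, h0⟩ := exists_radius hφ.2.1
  obtain ⟨M, hM, hMb⟩ := exists_bound hφ.continuous hφ.2.1
  obtain ⟨D, hD, hDb⟩ := exists_bound hψ.deriv.continuous hψ.deriv.2.1
  have hlip : ∀ a b, |ψ a - ψ b| ≤ D * |a - b| := fun a b =>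
    convex_univ.norm_image_sub_le_of_norm_deriv_le (fun y _ => hψ.differentiable y)
      (fun y _ => hDb y) (mem_univ b) (mem_univ a)
  have i1 := integrableOn_oneSided he hκ hφ.deriv.continuous hφ.deriv.2.1 x
  have i2 := integrableOn_oneSided he hκ hψφ.deriv.continuous hψφ.deriv.2.1 x
  -- Up to the factor `e`, both operators in the commutator together integrate `t^(-σ)` against the
  -- derivative of this one function, which vanishes to first order at `t = 0`.
  have hG : ∀ t, HasDerivAt (fun t => (ψ x - ψ (x + e * t)) * φ (x + e * t))
      (e * (ψ x * deriv φ (x + e * t) - deriv (fun y => ψ y * φ y) (x + e * t))) t := by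
    intro t
    have := ((hasDerivAt_comp_dir hψ e x t).const_sub (ψ x)).mul (hasDerivAt_comp_dir hφ e x t)
    refine this.congr_deriv ?_
    rw [hd]
    ring
  have i3 : IntegrableOn (fun t : ℝ => t ^ (-σ) *
      (e * (ψ x * deriv φ (x + e * t) - deriv (fun y => ψ y * φ y) (x + e * t)))) (Ioi 0) := by
    refine IntegrableOn.congr_fun (((i1.const_mul (ψ x)).sub i2).const_mul e) (fun t _ => ?_)
      measurableSet_Ioi
    simp only [Pi.sub_apply]
    ring
  have key := integral_rpow_mul_deriv hσ1 (R := |x| + R) (L := D * M) hG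
    (fun t ht => by rw [oneSided_eq_zero_of_far he h0 ht, mul_zero])
    (fun t ht => by
      rw [abs_mul]
      calc _ ≤ (D * |x - (x + e * t)|) * M :=
            mul_le_mul (hlip _ _) (hMb _) (abs_nonneg _) (by positivity)
        _ = D * M * t := by
            rw [sub_add_cancel_left, abs_neg, abs_mul, he, abs_of_pos ht]; ring) i3
  have e1 : ∀ t : ℝ, t ^ (-σ) *
      (e * (ψ x * deriv φ (x + e * t) - deriv (fun y => ψ y * φ y) (x + e * t))) =
      e * (ψ x * (t ^ (-σ) * deriv φ (x + e * t)) -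
        t ^ (-σ) * deriv (fun y => ψ y * φ y) (x + e * t)) := fun t => by ring
  have e2 : ∀ t : ℝ, (e * σ * t ^ (-(σ + 1)) * (ψ x - ψ (x + e * t))) * φ (x + e * t) =
      e * σ * (t ^ (-(σ + 1)) * ((ψ x - ψ (x + e * t)) * φ (x + e * t))) := fun t => by ring
  simp only [e1, integral_const_mul] at key
  rw [integral_sub (i1.const_mul _) i2, integral_const_mul] at key
  simp only [e2, integral_const_mul, oneSided]
  linear_combination e * key - (ψ x * (∫ t in Ioi 0, t ^ (-σ) * deriv φ (x + e * t)) -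
    ∫ t in Ioi 0, t ^ (-σ) * deriv (fun y => ψ y * φ y) (x + e * t)) * mul_self_of_abs_eq_one he

/-! ### The transposed operators behind the fractional product rule. -/

section
variable {e : ℝ} (he : |e| = 1) {p : ℝ≥0∞} (hp : 1 ≤ p)
include he hp

/-- For `t ≤ 1` the Lipschitz bound on `ψ` cancels one power of `t`, leaving `D t^(-σ)`; for `t > 1`
the bound `2 M t^(-(σ+1))` is used. -/
theorem exists_commutator_transpose {σ : ℝ} (hσ0 : 0 ≤ σ) (hσ1 : σ < 1) {ψ : ℝ → ℝ}
    (hψ : IsTestFunction univ ψ) :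
    ∃ C : ℝ≥0, ∀ (f : ℝ → ℝ) (A : ℝ≥0), LpBound p volume A f →
      ∃ w : ℝ → ℝ, LpBound p volume (C * A) w ∧
        ∀ φ : ℝ → ℝ, IsTestFunction univ φ →
          Integrable (fun x => f x * (ψ x * oneSided e (fun t => t ^ (-σ)) (deriv φ) x -
            oneSided e (fun t => t ^ (-σ)) (deriv fun y => ψ y * φ y) x)) ∧
          ∫ x, f x * (ψ x * oneSided e (fun t => t ^ (-σ)) (deriv φ) x -
            oneSided e (fun t => t ^ (-σ)) (deriv fun y => ψ y * φ y) x) = ∫ y, w y * φ y := by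
  obtain ⟨M, hM, hMb⟩ := exists_bound hψ.continuous hψ.2.1
  obtain ⟨D, hD, hDb⟩ := exists_bound hψ.deriv.continuous hψ.deriv.2.1
  have hlip : ∀ a b, |ψ a - ψ b| ≤ D * |a - b| := fun a b =>
    convex_univ.norm_image_sub_le_of_norm_deriv_le (fun y _ => hψ.differentiable y)
      (fun y _ => hDb y) (mem_univ b) (mem_univ a)
  -- For `σ = 0` the tail `t^(-1)` is not integrable, but the prefactor `σ` removes it.
  have hfar : IntegrableOn (fun t => σ * powFar (σ + 1) 1 t) (Ioi 0) := by
    rcases hσ0.eq_or_lt with h | h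
    · simp [← h]
    · exact (integrableOn_powFar (by linarith) one_pos).const_mul σ
  have hψm := hψ.continuous.measurable
  obtain ⟨C, hC⟩ := exists_transpose_lpBound he hp
    (h := fun t => D * (σ * powNear σ t) + 2 * M * (σ * powFar (σ + 1) 1 t))
    (k := fun x t => e * σ * t ^ (-(σ + 1)) * (ψ x - ψ (x + e * t)))
    ((((measurable_powNear _).const_mul _).const_mul _).add
      (((measurable_powFar _ _).const_mul _).const_mul _))
    ((((integrableOn_powNear hσ1).const_mul σ).const_mul D).add (hfar.const_mul _))
    (by
      simp only [Function.uncurry_def]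
      exact ((by fun_prop : Measurable fun z : ℝ × ℝ => e * σ * z.2 ^ (-(σ + 1)))).mul
        ((hψm.comp measurable_fst).sub (hψm.comp (by fun_prop))))
    (fun x t ht => by
      have hpos : 0 ≤ t ^ (-(σ + 1)) := Real.rpow_nonneg ht.le _
      rw [abs_mul, abs_mul, abs_mul, he, one_mul, abs_of_nonneg hσ0, abs_of_nonneg hpos]
      rcases le_or_gt t 1 with h | h
      · have h1 : powNear σ t = t ^ (-(σ + 1)) * t := by
          rw [powNear, indicator_of_mem (mem_Iic.2 h)]
          nth_rewrite 3 [← Real.rpow_one t]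
          rw [← Real.rpow_add ht]
          ring_nf
        have h2 : powFar (σ + 1) 1 t = 0 := indicator_of_notMem (notMem_Ioi.2 h) _
        rw [h1, h2]
        have := hlip x (x + e * t)
        rw [sub_add_cancel_left, abs_neg, abs_mul, he, abs_of_pos ht, one_mul] at this
        calc _ ≤ σ * t ^ (-(σ + 1)) * (D * t) := mul_le_mul_of_nonneg_left this (by positivity)
          _ = _ := by ring
      · have h1 : powNear σ t = 0 := indicator_of_notMem (notMem_Iic.2 h) _
        have h2 : powFar (σ + 1) 1 t = t ^ (-(σ + 1)) := indicator_of_mem (mem_Ioi.2 h) _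
        rw [h1, h2]
        have : |ψ x - ψ (x + e * t)| ≤ 2 * M := by
          have h3 := abs_sub (ψ x) (ψ (x + e * t))
          linarith [hMb x, hMb (x + e * t)]
        calc _ ≤ σ * t ^ (-(σ + 1)) * (2 * M) := mul_le_mul_of_nonneg_left this (by positivity)
          _ = _ := by ring)
  refine ⟨C, fun f A hf => ?_⟩
  obtain ⟨w, hw, hwφ⟩ := hC f A hf
  refine ⟨w, hw, fun φ hφ => ?_⟩
  simp only [oneSided_commutator he hσ1 hψ hφ]
  exact hwφ φ hφ

/-- Where `f` is nonzero, `ψ φ` vanishes within `2 δ`. So the kernel may be cut at `δ` and all `n`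
derivatives moved onto it without boundary terms; `σ + n > 1` makes the result integrable. No
smoothness of `f` is used. -/
theorem exists_offDiagonal_transpose {σ : ℝ} (hσ0 : 0 ≤ σ) {n : ℕ} (hn : 1 < σ + n)
    {δ : ℝ} (hδ : 0 < δ) {ψ : ℝ → ℝ} (hψ : IsTestFunction univ ψ) :
    ∃ C : ℝ≥0, ∀ (f : ℝ → ℝ) (A : ℝ≥0), LpBound p volume A f →
      (∀ x t, f x ≠ 0 → |t| < 2 * δ → ψ (x + t) = 0) →
      ∃ w : ℝ → ℝ, LpBound p volume (C * A) w ∧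
        ∀ φ : ℝ → ℝ, IsTestFunction univ φ →
          Integrable (fun x => f x *
            oneSided e (fun t => t ^ (-σ)) (iteratedDeriv n fun y => ψ y * φ y) x) ∧
          ∫ x, f x * oneSided e (fun t => t ^ (-σ)) (iteratedDeriv n fun y => ψ y * φ y) x =
            ∫ y, w y * φ y := by
  obtain ⟨M, hM, hMb⟩ := exists_bound hψ.continuous hψ.2.1
  obtain ⟨d, hd⟩ := exists_oneSided_powFar_iteratedDeriv he hδ n hσ0
  have hψm := hψ.continuous.measurable
  obtain ⟨C, hC⟩ := exists_transpose_lpBound he hp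
    (h := fun t => |d| * M * powFar (σ + n) δ t)
    (k := fun x t => d * powFar (σ + n) δ t * ψ (x + e * t))
    ((measurable_powFar _ _).const_mul _) ((integrableOn_powFar hn hδ).const_mul _)
    (by
      simp only [Function.uncurry_def]
      exact (((measurable_powFar _ _).comp measurable_snd).const_mul d).mul
        (hψm.comp (by fun_prop)))
    (fun x t _ => by
      rw [abs_mul, abs_mul, abs_of_nonneg (powFar_nonneg hδ t), mul_right_comm]
      exact mul_le_mul_of_nonneg_right (mul_le_mul_of_nonneg_left (hMb _) (abs_nonneg _))
        (powFar_nonneg hδ t))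
  refine ⟨C, fun f A hf hsep => ?_⟩
  obtain ⟨w, hw, hwφ⟩ := hC f A hf
  refine ⟨w, hw, fun φ hφ => ?_⟩
  have hψφ : IsTestFunction univ fun y => ψ y * φ y := hψ.mul_smooth hφ.1
  have heq : ∀ x, f x * oneSided e (fun t => t ^ (-σ)) (iteratedDeriv n fun y => ψ y * φ y) x =
      f x * ∫ t in Ioi 0, d * powFar (σ + n) δ t * ψ (x + e * t) * φ (x + e * t) := by
    intro x
    rcases eq_or_ne (f x) 0 with hx | hx
    · rw [hx, zero_mul, zero_mul]
    have h0 : ∀ t, |t| < 2 * δ → (fun y => ψ y * φ y) (x + t) = 0 := fun t ht => by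
      simp [hsep x t hx ht]
    have h1 : oneSided e (fun t => t ^ (-σ)) (iteratedDeriv n fun y => ψ y * φ y) x =
        oneSided e (powFar σ δ) (iteratedDeriv n fun y => ψ y * φ y) x := by
      refine setIntegral_congr_fun measurableSet_Ioi fun t ht => ?_
      by_cases h : δ < t
      · simp only [powFar, indicator_of_mem (mem_Ioi.2 h)]
      · have h2 := iteratedDeriv_eq_zero_of_near (η := fun y => ψ y * φ y) (x := x) h0 n (t := e * t)
          (show |e * t| < 2 * δ by rw [abs_mul, he, abs_of_pos (mem_Ioi.1 ht)]; linarith)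
        simp only [h2, mul_zero]
    rw [h1, hd x _ hψφ h0, oneSided, ← integral_const_mul]
    congr 1
    refine integral_congr_ae (ae_of_all _ fun t => ?_)
    simp only
    ring
  simp only [heq]
  exact hwφ φ hφ

/-- Functions with one more weak derivative have a fractional derivative. -/
theorem exists_fracDeriv_of_weakDeriv {σ : ℝ} (hσ0 : 0 ≤ σ) (hσ1 : σ < 1) :
    ∃ C : ℝ≥0, ∀ (r r' : ℝ → ℝ) (A : ℝ≥0), LpBound p volume A r → LpBound p volume A r' →
      IsWeakDeriv 1 univ r r' →
      ∃ w : ℝ → ℝ, LpBound p volume (C * A) w ∧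
        ∀ φ : ℝ → ℝ, IsTestFunction univ φ →
          Integrable (fun x => r x * oneSided e (fun t => t ^ (-σ)) (deriv φ) x) ∧
          ∫ x, r x * oneSided e (fun t => t ^ (-σ)) (deriv φ) x = ∫ y, w y * φ y := by
  have hfar : IntegrableOn (fun t => σ * powFar (σ + 1) 1 t) (Ioi 0) := by
    rcases hσ0.eq_or_lt with h | h
    · simp [← h]
    · exact (integrableOn_powFar (by linarith) one_pos).const_mul σ
  obtain ⟨C₁, hC₁⟩ := exists_transpose_lpBound he hp (k := fun _ t => σ * powFar (σ + 1) 1 t)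
    ((measurable_powFar _ _).const_mul σ) hfar
    (((measurable_powFar _ _).comp measurable_snd).const_mul σ)
    (fun x t _ => (abs_of_nonneg (mul_nonneg hσ0 (powFar_nonneg one_pos t))).le)
  obtain ⟨C₂, hC₂⟩ := exists_transpose_lpBound he hp (k := fun _ t => powNear σ t)
    (measurable_powNear σ) (integrableOn_powNear hσ1)
    ((measurable_powNear σ).comp measurable_snd)
    (fun x t ht => (abs_of_nonneg (powNear_nonneg ht)).le)
  have hκn : ∀ R, IntegrableOn (powNear σ) (Ioc 0 R) := fun R =>
    (integrableOn_powNear hσ1).mono_set fun t ht => ht.1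
  have hκf := integrableOn_powFar_Ioc hσ0 one_pos
  have hen : ‖e‖₊ = 1 := by rw [← NNReal.coe_inj]; simpa using he
  -- The three summands bound the tail kernel, the near kernel applied to `r'`, and the boundary
  -- translate `r (y - e)`.
  refine ⟨C₁ + C₂ + 1, fun r r' A hr hr' hw => ?_⟩
  obtain ⟨w₁, hw₁, hw₁φ⟩ := hC₁ r A hr
  obtain ⟨w₂, hw₂, hw₂φ⟩ := hC₂ r' A hr'
  have hmp : MeasurePreserving (fun y => y - e) volume volume := measurePreserving_sub_right volume e
  have hw₃ : LpBound p volume A fun y => r (y - e) :=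
    ⟨hr.1.comp_measurePreserving hmp,
      (eLpNorm_comp_measurePreserving hr.1 hmp).le.trans hr.2⟩
  have hloc : ∀ {g : ℝ → ℝ} {B : ℝ≥0}, LpBound p volume B g → LocallyIntegrableOn g univ :=
    fun hg => LpBound.locallyIntegrableOn (p := p) hp (by simpa using hg)
  refine ⟨fun y => (e * w₁ y + -1 * w₂ y) + -e * r (y - e), ?_, fun φ hφ => ?_⟩
  · have := (((hw₁.const_mul e).add hp (hw₂.const_mul (-1))).add hp (hw₃.const_mul (-e)))
    refine this.mono (le_of_eq ?_)
    rw [nnnorm_neg, nnnorm_neg, hen, nnnorm_one]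
    ring
  have hnear : IsTestFunction univ (oneSided e (powNear σ) φ) :=
    isTestFunction_oneSided he hκn (T := 1) (fun t ht => indicator_of_notMem (notMem_Iic.2 ht) _) hφ
  have hnd : deriv (oneSided e (powNear σ) φ) = oneSided e (powNear σ) (deriv φ) :=
    funext fun x => (hasDerivAt_oneSided he hκn hφ x).deriv
  -- The power is split at `t = 1`. The near part is the derivative of a test function, which the
  -- weak derivative of `r` absorbs; the far part is integrated by parts, with boundary value `φ (x
  -- + e)`.
  have hsplit : ∀ x, r x * oneSided e (fun t => t ^ (-σ)) (deriv φ) x =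
      r x * deriv (oneSided e (powNear σ) φ) x + ((-e) * (r x * φ (x + e)) +
        e * (r x * ∫ t in Ioi 0, σ * powFar (σ + 1) 1 t * φ (x + e * t))) := by
    intro x
    have h1 : oneSided e (fun t => t ^ (-σ)) (deriv φ) x =
        oneSided e (powNear σ) (deriv φ) x + oneSided e (powFar σ 1) (deriv φ) x := by
      rw [oneSided, oneSided, oneSided, ← integral_add
        (integrableOn_oneSided he hκn hφ.deriv.continuous hφ.deriv.2.1 x)
        (integrableOn_oneSided he hκf hφ.deriv.continuous hφ.deriv.2.1 x)]
      congr 1 with t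
      simp only [← powNear_add_powFar]
      ring
    have h2 : ∫ t in Ioi 0, σ * powFar (σ + 1) 1 t * φ (x + e * t) =
        σ * oneSided e (powFar (σ + 1) 1) φ x := by
      rw [oneSided, ← integral_const_mul]
      congr 1 with t
      ring
    rw [h1, h2, oneSided_powFar_deriv he hσ0 one_pos hφ, hnd, Real.one_rpow]
    simp only [mul_one]
    ring
  have i1 : Integrable fun x => r x * deriv (oneSided e (powNear σ) φ) x :=
    integrable_mul_test (hloc hr) hnear.deriv
  have i2' : Integrable fun y => r (y - e) * φ y := integrable_mul_test (hloc hw₃) hφ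
  have i2 : Integrable fun x => r x * φ (x + e) := by
    simpa using i2'.comp_add_right e
  have e2 : ∫ x, r x * φ (x + e) = ∫ y, r (y - e) * φ y := by
    simpa using integral_add_right_eq_self (fun y => r (y - e) * φ y) e
  have e1 : ∫ x, r x * deriv (oneSided e (powNear σ) φ) x = -∫ y, w₂ y * φ y := by
    have := hw.2 _ hnear
    rw [Measure.restrict_univ, iteratedDeriv_one, pow_one] at this
    rw [← (hw₂φ φ hφ).2]
    simp only [oneSided] at this ⊢
    linarith
  obtain ⟨i3, e3⟩ := hw₁φ φ hφ
  simp only [hsplit]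
  have i4 : Integrable fun x => (-e) * (r x * φ (x + e)) +
      e * (r x * ∫ t in Ioi 0, σ * powFar (σ + 1) 1 t * φ (x + e * t)) :=
    (i2.const_mul (-e)).add (i3.const_mul e)
  refine ⟨i1.add i4, ?_⟩
  rw [integral_add i1 i4, integral_add (i2.const_mul _) (i3.const_mul _), integral_const_mul,
    integral_const_mul, e1, e2, e3]
  have e4 : ∀ y, (e * w₁ y + -1 * w₂ y + -e * r (y - e)) * φ y =
      (e * (w₁ y * φ y) + -1 * (w₂ y * φ y)) + -e * (r (y - e) * φ y) := fun y => by ring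
  have j1 := integrable_mul_test (hloc hw₁) hφ
  have j2 := integrable_mul_test (hloc hw₂) hφ
  have j3 : Integrable fun y => e * (w₁ y * φ y) + -1 * (w₂ y * φ y) :=
    (j1.const_mul _).add (j2.const_mul _)
  simp only [e4]
  rw [integral_add j3 (i2'.const_mul _),
    integral_add (j1.const_mul _) (j2.const_mul _)]
  simp only [integral_const_mul]
  ring

end

/-! ### The fractional derivative of a product with a cutoff. -/

theorem integrable_mul_of_far {f g : ℝ → ℝ} {R : ℝ} (hf : LocallyIntegrableOn f univ)
    (h0 : ∀ x, R < |x| → f x = 0) (hg : Continuous g) : Integrable fun x => f x * g x := by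
  have hK : IsCompact (Metric.closedBall (0 : ℝ) R) := isCompact_closedBall _ _
  have h1 : IntegrableOn (fun x => f x * g x) (Metric.closedBall (0 : ℝ) R) :=
    (hf.integrableOn_compact_subset (subset_univ _) hK).mul_continuousOn hg.continuousOn hK
  refine (integrableOn_iff_integrable_of_support_subset fun x hx => ?_).1 h1
  by_contra hx'
  exact hx (by simp [h0 x (by simpa using hx')])

theorem IsTestFunction.exists_radius_tsupport {Ω : Set ℝ} {ψ : ℝ → ℝ} (h : IsTestFunction Ω ψ) :
    ∃ R, ∀ x, R < |x| → x ∉ tsupport ψ := by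
  obtain ⟨R, _, hs⟩ := h.2.1.isBounded.exists_pos_norm_le
  exact ⟨R, fun x hx h => absurd (hs x h) (not_le.2 hx)⟩

/-- Multiplication by a test function `ψ` on `Ω` maps functions with a fractional derivative on
`Ω` to functions with a fractional derivative on the line. -/
theorem exists_weakFracDeriv_mul {p : ℝ≥0∞} (hp : 1 ≤ p) {Ω : Set ℝ} (hΩ : MeasurableSet Ω)
    {ψ χ : ℝ → ℝ} (hψ : IsTestFunction Ω ψ) (hχ : IsTestFunction Ω χ) {δ : ℝ} (hδ : 0 < δ)
    (hsep : ∀ x t, χ x ≠ 1 → |t| < 2 * δ → ψ (x + t) = 0) (s : Side) {α : ℝ} (hα : 0 < α) :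
    ∃ C : ℝ≥0, ∀ (u : ℕ → ℝ → ℝ) (v : ℝ → ℝ) (A : ℝ≥0), SobFamily ⌊α⌋₊ p Ω A u →
      LpBound p (volume.restrict Ω) A v → IsWeakFracDeriv s α Ω (u 0) v →
      ∃ V : ℝ → ℝ, LpBound p volume (C * A) V ∧
        IsWeakFracDeriv s α univ (fun x => ψ x * u 0 x) V := by
  set m := ⌊α⌋₊ with hm
  set σ : ℝ := α - m with hσ
  set e := s.opp.dir with he'
  have he : |e| = 1 := s.opp.abs_dir
  have hσ0 : 0 ≤ σ := sub_nonneg.2 (Nat.floor_le hα.le)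
  have hσ1 : σ < 1 := by linarith [Nat.lt_floor_add_one α]
  have hκ := integrableOn_rpow_Ioc (by linarith : -1 < -σ)
  set ε : ℝ := (-e) ^ (m + 1) * (Real.Gamma (m + 1 - α))⁻¹ with hε
  set S : (ℝ → ℝ) → ℝ → ℝ := oneSided e (fun t => t ^ (-σ)) with hS
  have hD : ∀ {φ : ℝ → ℝ}, IsTestFunction univ φ → ∀ x,
      rlDeriv s.opp α φ x = ε * S (iteratedDeriv (m + 1) φ) x := fun hφ x => by
    rw [rlDeriv_eq s.opp α hφ]
  have hSd : ∀ {φ : ℝ → ℝ}, IsTestFunction univ φ →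
      iteratedDeriv m (S (deriv φ)) = S (iteratedDeriv (m + 1) φ) := fun hφ => by
    rw [hS, iteratedDeriv_oneSided he hκ hφ.deriv, iteratedDeriv_succ']
  have hψu := hψ.univ
  obtain ⟨R, hR⟩ := hψ.exists_radius_tsupport
  obtain ⟨R', hR'⟩ := hχ.exists_radius_tsupport
  obtain ⟨M, hM, hMb⟩ := exists_bound hχ.continuous hχ.2.1
  obtain ⟨C₁, hC₁⟩ := leibniz_sobFamily hp hΩ m hχ
  obtain ⟨C₂, hC₂⟩ := leibniz_sobFamily hp MeasurableSet.univ m hψu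
  obtain ⟨Cr, hCr⟩ := leibnizRem_lpBound hp MeasurableSet.univ m hψu
  obtain ⟨Cr', hCr'⟩ := leibnizRemDeriv_lpBound hp MeasurableSet.univ m hψu
  obtain ⟨Ca, hCa⟩ := exists_commutator_transpose he hp hσ0 hσ1 hψu
  obtain ⟨Cb, hCb⟩ := exists_fracDeriv_of_weakDeriv he hp hσ0 hσ1
  -- The exponent is `σ + m + 1 = α + 1`, which exceeds `1` because `α > 0`.
  obtain ⟨Cd, hCd⟩ := exists_offDiagonal_transpose he hp hσ0 (n := m + 1)
    (by
      push_cast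
      rcases Nat.eq_zero_or_pos m with h | h
      · rw [hσ, h]; simpa using hα
      · have : (1 : ℝ) ≤ m := by exact_mod_cast h
        linarith) hδ hψu
  obtain ⟨Cv, hCv⟩ := LpBound.mul_test (p := p) hΩ hψ
  refine ⟨Cv + ‖ε‖₊ * (Ca * C₁ + Cb * ((Cr + Cr') * C₁)) +
    ‖-((-1) ^ m * ε)‖₊ * (Cd * (1 + ⟨M, hM⟩)), fun u v A hu hv hfrac => ?_⟩
  set U : ℕ → ℝ → ℝ := fun k => leibniz k χ u with hU
  have hUs : SobFamily m p univ (C₁ * A) U := hC₁ u A hu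
  have hLs : SobFamily m p univ (C₂ * (C₁ * A)) fun k => leibniz k ψ U := hC₂ U _ hUs
  have hUm : LpBound p volume (C₁ * A) (U m) := by simpa using hUs.1 m le_rfl
  have hrem := hCr U _ hUs
  have hrem' := hCr' U _ hUs
  obtain ⟨w₁, hw₁, hw₁φ⟩ := hCa _ _ hUm
  obtain ⟨w₂, hw₂, hw₂φ⟩ := hCb (leibnizRem m ψ U) (leibnizRemDeriv m ψ U)
    ((Cr + Cr') * (C₁ * A)) (hrem.mono (by gcongr; exact le_self_add))
    (hrem'.mono (by gcongr; exact le_add_self))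
    (leibnizRem_isWeakDeriv hp MeasurableSet.univ hψu hUs)
  -- This is the part of `u` on `Ω` not captured by `χ u`; it lives where `χ ≠ 1`, at distance at
  -- least `2 δ` from the nonzero set of `ψ`.
  have hf₄ : LpBound p volume ((1 + ⟨M, hM⟩) * A) (Ω.indicator fun x => (1 - χ x) * u 0 x) := by
    refine LpBound.of_restrict hΩ ?_ fun x hx => indicator_of_notMem hx _
    have h1 : LpBound p (volume.restrict Ω) ((1 + ⟨M, hM⟩) * A) fun x => (1 - χ x) * u 0 x := by
      refine (hu.1 0 (Nat.zero_le _)).mul_bdd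
        (continuous_const.sub hχ.continuous).aestronglyMeasurable fun x => ?_
      have := abs_sub 1 (χ x)
      rw [abs_one] at this
      exact this.trans (add_le_add_right (hMb x) 1)
    have h2 := indicator_ae_eq_restrict (μ := volume) (f := fun x => (1 - χ x) * u 0 x) hΩ
    exact ⟨h1.1.congr h2.symm, (eLpNorm_congr_ae h2).le.trans h1.2⟩
  obtain ⟨w₄, hw₄, hw₄φ⟩ := hCd _ _ hf₄ (by
    intro x t hx ht
    refine hsep x t (fun h => hx ?_) ht
    by_cases hxΩ : x ∈ Ω
    · rw [indicator_of_mem hxΩ, h, sub_self, zero_mul]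
    · exact indicator_of_notMem hxΩ _)
  have hV := ((hCv v A hv).add hp ((hw₁.add hp hw₂).const_mul ε)).add hp
    (hw₄.const_mul (-((-1) ^ m * ε)))
  have hloc : ∀ {g : ℝ → ℝ} {B : ℝ≥0}, LpBound p volume B g → LocallyIntegrableOn g univ :=
    fun hg => LpBound.locallyIntegrableOn (p := p) hp (by simpa using hg)
  refine ⟨_, hV.mono (le_of_eq (by ring)), hloc hV, fun φ hφ => ?_⟩
  have hψφ : IsTestFunction Ω fun y => ψ y * φ y := hψ.mul_smooth hφ.1
  have hL0 : ∀ x, leibniz 0 ψ U x = ψ x * u 0 x := by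
    intro x
    show ψ x * (χ x * u 0 x) = _
    by_cases h : χ x = 1
    · rw [h, one_mul]
    · have := hsep x 0 h (by simpa using hδ)
      rw [add_zero] at this
      rw [this, zero_mul, zero_mul]
  have hSc : ∀ {η : ℝ → ℝ}, IsTestFunction univ η → Continuous (S η) := fun hη =>
    (contDiff_oneSided he hκ hη).continuous
  have hL0loc : LocallyIntegrableOn (leibniz 0 ψ U) univ :=
    (hLs.1 0 (Nat.zero_le _)).locallyIntegrableOn hp
  have i0 : Integrable fun x => leibniz 0 ψ U x * S (iteratedDeriv (m + 1) φ) x :=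
    integrable_mul_of_far hL0loc (fun x hx => leibniz_eq_zero 0 U (hR x hx))
      (hSc (hφ.iteratedDeriv _))
  have hprod : ∀ x, ψ x * u 0 x * rlDeriv s.opp α φ x =
      ε * (leibniz 0 ψ U x * S (iteratedDeriv (m + 1) φ) x) := fun x => by
    rw [hD hφ, hL0]; ring
  simp only [hprod, Measure.restrict_univ, integrableOn_univ]
  refine ⟨i0.const_mul ε, ?_⟩
  -- `S (deriv φ)` is smooth but need not have compact support; the compact support of the cutoff
  -- product justifies integrating by parts.
  have T1 : ∫ x, leibniz m ψ U x * S (deriv φ) x =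
      (-1) ^ m * ∫ x, leibniz 0 ψ U x * S (iteratedDeriv (m + 1) φ) x := by
    rw [← hSd hφ]
    exact (hLs.isWeakDeriv hp le_rfl).integral_smooth
      (fun x hx => leibniz_eq_zero 0 U (hR x hx)) (fun x hx => leibniz_eq_zero m U (hR x hx))
      (contDiff_oneSided he hκ hφ.deriv)
  have T2 : ∫ x, U m x * S (deriv fun y => ψ y * φ y) x =
      (-1) ^ m * ∫ x, U 0 x * S (iteratedDeriv (m + 1) fun y => ψ y * φ y) x := by
    rw [← hSd hψφ.univ]
    exact (hUs.isWeakDeriv hp le_rfl).integral_smooth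
      (fun x hx => leibniz_eq_zero 0 u (hR' x hx)) (fun x hx => leibniz_eq_zero m u (hR' x hx))
      (contDiff_oneSided he hκ hψφ.univ.deriv)
  obtain ⟨j1, k1⟩ := hw₁φ φ hφ
  obtain ⟨j2, k2⟩ := hw₂φ φ hφ
  obtain ⟨j4, k4⟩ := hw₄φ φ hφ
  have j3 : Integrable fun x => U m x * S (deriv fun y => ψ y * φ y) x :=
    integrable_mul_of_far (hloc hUm) (fun x hx => leibniz_eq_zero m u (hR' x hx))
      (hSc hψφ.univ.deriv)
  -- The top-order term `ψ U m` is rewritten through the commutator, the lower-order terms through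
  -- `w₂`; only `S` of `ψ φ` against `U m` remains.
  have T3 : ∫ x, leibniz m ψ U x * S (deriv φ) x = (∫ y, w₁ y * φ y) + (∫ y, w₂ y * φ y) +
      ∫ x, U m x * S (deriv fun y => ψ y * φ y) x := by
    have j12 : Integrable fun x => U m x * (ψ x * S (deriv φ) x - S (deriv fun y => ψ y * φ y) x) +
        leibnizRem m ψ U x * S (deriv φ) x := j1.add j2
    rw [← k1, ← k2, ← integral_add j1 j2, ← integral_add j12 j3]
    congr 1 with x
    rw [leibniz_eq]
    ring
  obtain ⟨j5, k5⟩ := hfrac.2 _ hψφ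
  -- On `Ω`, `χ u = u - (1 - χ) u`: the first term is tested by the hypothesis on `v`, the second is
  -- the off-diagonal error `w₄`.
  have T4 : ε * ∫ x, U 0 x * S (iteratedDeriv (m + 1) fun y => ψ y * φ y) x =
      (∫ x in Ω, u 0 x * rlDeriv s.opp α (fun y => ψ y * φ y) x) - ε * ∫ y, w₄ y * φ y := by
    rw [← k4, ← integral_const_mul, ← integral_const_mul, ← integral_indicator hΩ,
      ← integral_sub (IntegrableOn.integrable_indicator j5 hΩ) (j4.const_mul ε)]
    congr 1 with x
    by_cases hx : x ∈ Ω
    · rw [indicator_of_mem hx, indicator_of_mem hx, hD hψφ.univ]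
      show ε * (χ x * u 0 x * _) = _
      ring
    · rw [indicator_of_notMem hx, indicator_of_notMem hx]
      show ε * (χ x * u 0 x * _) = _
      rw [hχ.eq_zero hx]
      ring
  have T5 : ∫ x in Ω, v x * (ψ x * φ x) = ∫ x, v x * (ψ x * φ x) := setIntegral_mul_test v hψφ
  have l1 := integrable_mul_test (hloc hw₁) hφ
  have l2 := integrable_mul_test (hloc hw₂) hφ
  have l4 := integrable_mul_test (hloc hw₄) hφ
  have l0 : Integrable fun x => v x * (ψ x * φ x) :=
    integrable_mul_test (hv.locallyIntegrableOn hp) hψφ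
  have lsum : ∫ x, (ψ x * v x + ε * (w₁ x + w₂ x) + -((-1) ^ m * ε) * w₄ x) * φ x =
      (∫ x, v x * (ψ x * φ x)) + ε * ((∫ y, w₁ y * φ y) + ∫ y, w₂ y * φ y) +
        -((-1) ^ m * ε) * ∫ y, w₄ y * φ y := by
    have l12 : Integrable fun x => ε * (w₁ x * φ x + w₂ x * φ x) := (l1.add l2).const_mul ε
    have l012 : Integrable fun x => v x * (ψ x * φ x) + ε * (w₁ x * φ x + w₂ x * φ x) :=
      l0.add l12
    rw [← integral_add l1 l2, ← integral_const_mul, ← integral_const_mul, ← integral_add l0 l12,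
      ← integral_add l012 (l4.const_mul _)]
    congr 1 with x
    ring
  rw [lsum, integral_const_mul, ← hm]
  rw [← hm] at k5
  linear_combination -T5 + k5 - (-1) ^ m * T4 - ε * T2 - ε * T3 + ε * T1

/-! ### From representatives to `L^p` classes and norms. -/

section
variable {p : ℝ≥0∞} {Ω : Set ℝ}

theorem IsWeakDeriv.congr_left {k : ℕ} {u u' v : ℝ → ℝ} (h : IsWeakDeriv k Ω u v)
    (hu : u =ᵐ[volume.restrict Ω] u') : IsWeakDeriv k Ω u' v := by
  refine ⟨h.1, fun φ hφ => ?_⟩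
  rw [h.2 φ hφ]
  congr 1
  refine integral_congr_ae ?_
  filter_upwards [hu] with x hx
  rw [hx]

theorem LocallyIntegrableOn.congr_restrict {v v' : ℝ → ℝ} (h : LocallyIntegrableOn v Ω)
    (hv : v =ᵐ[volume.restrict Ω] v') : LocallyIntegrableOn v' Ω := by
  intro x hx
  obtain ⟨t, ht, hi⟩ := h x hx
  refine ⟨t ∩ Ω, inter_mem ht self_mem_nhdsWithin, ?_⟩
  exact (hi.mono_set inter_subset_left).congr_fun_ae
    (ae_restrict_of_ae_restrict_of_subset inter_subset_right hv)

theorem IsWeakDeriv.congr_right {k : ℕ} {u v v' : ℝ → ℝ}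
    (h : IsWeakDeriv k Ω u v) (hv : v =ᵐ[volume.restrict Ω] v') : IsWeakDeriv k Ω u v' := by
  refine ⟨LocallyIntegrableOn.congr_restrict h.1 hv, fun φ hφ => ?_⟩
  rw [← h.2 φ hφ]
  refine integral_congr_ae ?_
  filter_upwards [hv] with x hx
  rw [hx]

theorem IsWeakFracDeriv.congr {s : Side} {α : ℝ} {u u' v v' : ℝ → ℝ}
    (h : IsWeakFracDeriv s α Ω u v) (hu : u =ᵐ[volume.restrict Ω] u')
    (hv : v =ᵐ[volume.restrict Ω] v') : IsWeakFracDeriv s α Ω u' v' := by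
  refine ⟨LocallyIntegrableOn.congr_restrict h.1 hv, fun φ hφ => ?_⟩
  have e1 : (fun x => u x * rlDeriv s.opp α φ x) =ᵐ[volume.restrict Ω]
      fun x => u' x * rlDeriv s.opp α φ x := by
    filter_upwards [hu] with x hx
    rw [hx]
  have e2 : (fun x => v x * φ x) =ᵐ[volume.restrict Ω] fun x => v' x * φ x := by
    filter_upwards [hv] with x hx
    rw [hx]
  exact ⟨(h.2 φ hφ).1.congr e1, by
    rw [← integral_congr_ae e1, ← integral_congr_ae e2, (h.2 φ hφ).2]⟩

theorem isWeakDeriv_weakDeriv {k : ℕ} {u : LpOn p Ω} (h : ∃ v : LpOn p Ω, IsWeakDeriv k Ω u v) :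
    IsWeakDeriv k Ω u (weakDeriv k u) := by
  rw [weakDeriv, dif_pos h]
  exact h.choose_spec

theorem isWeakFracDeriv_weakFracDeriv {s : Side} {α : ℝ} {u : LpOn p Ω}
    (h : ∃ v : LpOn p Ω, IsWeakFracDeriv s α Ω u v) :
    IsWeakFracDeriv s α Ω u (weakFracDeriv s α u) := by
  rw [weakFracDeriv, dif_pos h]
  exact h.choose_spec

theorem norm_le_of_ae_eq {u : LpOn p Ω} {f : ℝ → ℝ} {B : ℝ≥0}
    (hf : LpBound p (volume.restrict Ω) B f) (h : u =ᵐ[volume.restrict Ω] f) : ‖u‖ ≤ B := by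
  rw [Lp.norm_def, eLpNorm_congr_ae h]
  exact ENNReal.toReal_le_coe_of_le_coe hf.2

theorem lpBound_of_norm_le {u : LpOn p Ω} {N : ℝ} (h : ‖u‖ ≤ N) :
    LpBound p (volume.restrict Ω) N.toNNReal u := by
  refine ⟨Lp.aestronglyMeasurable u, ?_⟩
  rw [← ENNReal.ofReal_toReal (Lp.eLpNorm_ne_top u), ← Lp.norm_def]
  exact ENNReal.ofReal_le_ofReal h

theorem sobolevNorm_nonneg (m : ℕ) (u : LpOn p Ω) : 0 ≤ sobolevNorm m u := by
  rw [sobolevNorm]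
  have h : ∀ k, 0 ≤ ‖weakDeriv k u‖ := fun k => ENNReal.toReal_nonneg
  split_ifs
  · exact Finset.sum_nonneg fun k _ => h k
  · exact Real.rpow_nonneg (Finset.sum_nonneg fun k _ => Real.rpow_nonneg (h k) _) _

theorem le_rpow_add_rpow {a b q : ℝ} (hq : 1 ≤ q) (ha : 0 ≤ a) (hb : 0 ≤ b) :
    a ≤ (a ^ q + b ^ q) ^ (1 / q) := by
  have hq0 : 0 < q := by linarith
  calc a = (a ^ q) ^ (1 / q) := by
        rw [← Real.rpow_mul ha, mul_one_div_cancel hq0.ne', Real.rpow_one]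
    _ ≤ _ := by
        refine Real.rpow_le_rpow (Real.rpow_nonneg ha _) ?_ (by positivity)
        linarith [Real.rpow_nonneg hb q]

theorem one_le_toReal (hp : 1 ≤ p) (ht : p ≠ ⊤) : 1 ≤ p.toReal := by
  simpa using (ENNReal.toReal_le_toReal (by simp) ht).2 hp

theorem norm_weakDeriv_le_sobolevNorm (hp : 1 ≤ p) {m k : ℕ} (hk : k ≤ m) (u : LpOn p Ω) :
    ‖weakDeriv k u‖ ≤ sobolevNorm m u := by
  have h : ∀ k, 0 ≤ ‖weakDeriv k u‖ := fun k => ENNReal.toReal_nonneg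
  have hmem : k ∈ Finset.range (m + 1) := Finset.mem_range.2 (by lia)
  rw [sobolevNorm]
  split_ifs with ht
  · exact Finset.single_le_sum (f := fun k => ‖weakDeriv k u‖) (fun k _ => h k) hmem
  · have hq0 : 0 < p.toReal := by linarith [one_le_toReal hp ht]
    calc ‖weakDeriv k u‖ = (‖weakDeriv k u‖ ^ p.toReal) ^ (1 / p.toReal) := by
          rw [← Real.rpow_mul (h k), mul_one_div_cancel hq0.ne', Real.rpow_one]
      _ ≤ _ := by
          refine Real.rpow_le_rpow (Real.rpow_nonneg (h k) _) ?_ (by positivity)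
          exact Finset.single_le_sum (f := fun k => ‖weakDeriv k u‖ ^ p.toReal)
            (fun k _ => Real.rpow_nonneg (h k) _) hmem

theorem sobolevNorm_le_fracSobolevNorm (hp : 1 ≤ p) (s : Side) (α : ℝ) (u : LpOn p Ω) :
    sobolevNorm ⌊α⌋₊ u ≤ fracSobolevNorm s α u := by
  have h : 0 ≤ ‖weakFracDeriv s α u‖ := ENNReal.toReal_nonneg
  rw [fracSobolevNorm]
  split_ifs with ht
  · linarith
  · exact le_rpow_add_rpow (one_le_toReal hp ht) (sobolevNorm_nonneg _ u) h

theorem norm_weakFracDeriv_le_fracSobolevNorm (hp : 1 ≤ p) (s : Side) (α : ℝ) (u : LpOn p Ω) :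
    ‖weakFracDeriv s α u‖ ≤ fracSobolevNorm s α u := by
  have h : 0 ≤ ‖weakFracDeriv s α u‖ := ENNReal.toReal_nonneg
  rw [fracSobolevNorm]
  split_ifs with ht
  · linarith [sobolevNorm_nonneg ⌊α⌋₊ u]
  · rw [add_comm]
    exact le_rpow_add_rpow (one_le_toReal hp ht) h (sobolevNorm_nonneg _ u)

theorem sobolevNorm_le (hp : 1 ≤ p) {m : ℕ} {u : LpOn p Ω} {B : ℝ}
    (hB : ∀ k ≤ m, ‖weakDeriv k u‖ ≤ B) : sobolevNorm m u ≤ (m + 1) * B := by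
  have h : ∀ k, 0 ≤ ‖weakDeriv k u‖ := fun k => ENNReal.toReal_nonneg
  have hB0 : 0 ≤ B := (h 0).trans (hB 0 (Nat.zero_le _))
  have hk : ∀ k ∈ Finset.range (m + 1), ‖weakDeriv k u‖ ≤ B := fun k hk =>
    hB k (by have := Finset.mem_range.1 hk; lia)
  rw [sobolevNorm]
  split_ifs with ht
  · refine (Finset.sum_le_card_nsmul _ _ B hk).trans (le_of_eq ?_)
    simp
  · have hq := one_le_toReal hp ht
    have hq0 : 0 < p.toReal := by linarith
    have h1 : ∑ k ∈ Finset.range (m + 1), ‖weakDeriv k u‖ ^ p.toReal ≤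
        ((m + 1) * B) ^ p.toReal := by
      refine (Finset.sum_le_card_nsmul _ _ (B ^ p.toReal) fun k hk' =>
        Real.rpow_le_rpow (h k) (hk k hk') hq0.le).trans ?_
      rw [Real.mul_rpow (by positivity) hB0, Finset.card_range, nsmul_eq_mul]
      push_cast
      refine mul_le_mul_of_nonneg_right ?_ (Real.rpow_nonneg hB0 _)
      -- Since `m + 1 ≥ 1` and `p ≥ 1`, the number of terms is at most its own `p`-th power.
      calc (m + 1 : ℝ) = (m + 1 : ℝ) ^ (1 : ℝ) := (Real.rpow_one _).symm
        _ ≤ _ := Real.rpow_le_rpow_of_exponent_le (by linarith [Nat.cast_nonneg (α := ℝ) m]) hq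
    refine (Real.rpow_le_rpow (Finset.sum_nonneg fun k _ => Real.rpow_nonneg (h k) _) h1
      (by positivity)).trans (le_of_eq ?_)
    rw [← Real.rpow_mul (by positivity), mul_one_div_cancel hq0.ne', Real.rpow_one]

theorem fracSobolevNorm_le (hp : 1 ≤ p) {s : Side} {α : ℝ} {u : LpOn p Ω} {B : ℝ}
    (hB : ∀ k ≤ ⌊α⌋₊, ‖weakDeriv k u‖ ≤ B) (hF : ‖weakFracDeriv s α u‖ ≤ B) :
    fracSobolevNorm s α u ≤ (⌊α⌋₊ + 2) * B := by
  have h1 := sobolevNorm_le hp hB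
  have h : 0 ≤ ‖weakFracDeriv s α u‖ := ENNReal.toReal_nonneg
  have h2 : fracSobolevNorm s α u ≤ sobolevNorm ⌊α⌋₊ u + ‖weakFracDeriv s α u‖ := by
    rw [fracSobolevNorm]
    split_ifs with ht
    · exact le_rfl
    · exact Real.rpow_add_rpow_le_add (sobolevNorm_nonneg _ u) h (one_le_toReal hp ht)
  linarith

theorem fracSobolevNorm_nonneg (hp : 1 ≤ p) (s : Side) (α : ℝ) (u : LpOn p Ω) :
    0 ≤ fracSobolevNorm s α u :=
  (sobolevNorm_nonneg _ u).trans (sobolevNorm_le_fracSobolevNorm hp s α u)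

/-- The weak derivatives of an element of the fractional Sobolev space form a bounded family. -/
theorem sobFamily_weakDeriv (hp : 1 ≤ p) {s : Side} {α : ℝ} {u : LpOn p Ω}
    (hu : u ∈ sobolevSpace ⌊α⌋₊ p Ω) :
    SobFamily ⌊α⌋₊ p Ω (fracSobolevNorm s α u).toNNReal fun k => weakDeriv k u :=
  ⟨fun _ hk => lpBound_of_norm_le ((norm_weakDeriv_le_sobolevNorm hp hk u).trans
      (sobolevNorm_le_fracSobolevNorm hp s α u)),
    fun k hk => (isWeakDeriv_weakDeriv (hu k hk.le)).one_of_succ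
      (isWeakDeriv_weakDeriv (hu (k + 1) hk))⟩

/-- `weakDeriv` is picked by choice, so even at order `0` its identity with `u` goes through
uniqueness. -/
theorem weakDeriv_zero_ae_eq (hp : 1 ≤ p) (hΩ : IsOpen Ω) (u : LpOn p Ω) :
    weakDeriv 0 u =ᵐ[volume.restrict Ω] u := by
  have h0 : IsWeakDeriv 0 Ω u u :=
    isWeakDeriv_zero ((lpBound_of_norm_le (le_refl ‖u‖)).locallyIntegrableOn hp)
  exact (isWeakDeriv_weakDeriv ⟨u, h0⟩).unique hΩ h0

end

/-- A function on the line with its weak derivatives, given by representatives, is an element of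
the fractional Sobolev space. -/
theorem exists_fracSobolevSpace_of_sobFamily {p : ℝ≥0∞} (hp : 1 ≤ p) {s : Side} {α : ℝ} {B : ℝ≥0}
    {g : ℕ → ℝ → ℝ} {V : ℝ → ℝ} (hg : SobFamily ⌊α⌋₊ p univ B g)
    (hV : LpBound p volume B V) (hgV : IsWeakFracDeriv s α univ (g 0) V) :
    ∃ w : fracSobolevSpace s α p (univ : Set ℝ), w.1 =ᵐ[volume] g 0 ∧
      fracSobolevNorm s α w.1 ≤ (⌊α⌋₊ + 2) * B := by
  have hV' : LpBound p (volume.restrict univ) B V := by simpa using hV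
  set w : LpOn p univ := (hg.1 0 (Nat.zero_le _)).memLp.toLp (g 0) with hw
  have hwg : w =ᵐ[volume.restrict univ] g 0 := MemLp.coeFn_toLp _
  have h1 : ∀ k (hk : k ≤ ⌊α⌋₊), IsWeakDeriv k univ w ((hg.1 k hk).memLp.toLp (g k)) :=
    fun k hk => ((hg.isWeakDeriv hp hk).congr_left hwg.symm).congr_right
      (MemLp.coeFn_toLp _).symm
  have h2 : IsWeakFracDeriv s α univ w (hV'.memLp.toLp V) :=
    hgV.congr hwg.symm (MemLp.coeFn_toLp _).symm
  refine ⟨⟨w, fun k hk => ⟨_, h1 k hk⟩, ⟨_, h2⟩⟩, by simpa using hwg, ?_⟩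
  refine fracSobolevNorm_le hp (fun k hk => ?_) ?_
  · exact norm_le_of_ae_eq (hg.1 k hk) (((isWeakDeriv_weakDeriv ⟨_, h1 k hk⟩).unique isOpen_univ
      (h1 k hk)).trans (MemLp.coeFn_toLp _))
  · exact norm_le_of_ae_eq hV' (((isWeakFracDeriv_weakFracDeriv ⟨_, h2⟩).unique isOpen_univ
      h2).trans (MemLp.coeFn_toLp _))

/-! ### The extension operator. -/

/-- Multiplication by a cutoff is bounded from the fractional Sobolev space of an open set to that
of the line. -/
theorem exists_cutoff_extension {p : ℝ≥0∞} (hp : 1 ≤ p) {Ω : Set ℝ} (hΩ : IsOpen Ω)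
    {ψ χ : ℝ → ℝ} (hψ : IsTestFunction Ω ψ) (hχ : IsTestFunction Ω χ) {δ : ℝ} (hδ : 0 < δ)
    (hsep : ∀ x t, χ x ≠ 1 → |t| < 2 * δ → ψ (x + t) = 0) (s : Side) {α : ℝ} (hα : 0 < α) :
    ∃ C : ℝ, 0 < C ∧ ∀ u : fracSobolevSpace s α p Ω, ∃ w : fracSobolevSpace s α p (univ : Set ℝ),
      (∀ᵐ x, x ∈ Ω → w.1 x = ψ x * u.1 x) ∧ (∀ᵐ x, ψ x = 0 → w.1 x = 0) ∧
      fracSobolevNorm s α w.1 ≤ C * fracSobolevNorm s α u.1 := by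
  obtain ⟨C₁, hC₁⟩ := leibniz_sobFamily hp hΩ.measurableSet ⌊α⌋₊ hψ
  obtain ⟨C₂, hC₂⟩ := exists_weakFracDeriv_mul hp hΩ.measurableSet hψ hχ hδ hsep s hα
  -- The factor counts the derivatives of orders `0, …, [α]` together with the fractional one.
  refine ⟨(⌊α⌋₊ + 2) * (C₁ + C₂ + 1), by positivity, fun u => ?_⟩
  have hN := fracSobolevNorm_nonneg hp s α u.1
  set N := fracSobolevNorm s α u.1 with hNdef
  have hfam := sobFamily_weakDeriv hp (s := s) u.2.1
  have hu0 := weakDeriv_zero_ae_eq hp hΩ u.1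
  have hv := lpBound_of_norm_le (norm_weakFracDeriv_le_fracSobolevNorm hp s α u.1)
  obtain ⟨V, hV, hVw⟩ := hC₂ _ _ _ hfam hv
    ((isWeakFracDeriv_weakFracDeriv u.2.2).congr hu0.symm (EventuallyEq.refl _ _))
  have hg := hC₁ _ _ hfam
  have hb1 : C₁ * N.toNNReal ≤ (C₁ + C₂ + 1) * N.toNNReal := by
    gcongr
    rw [add_assoc]
    exact le_self_add
  have hb2 : C₂ * N.toNNReal ≤ (C₁ + C₂ + 1) * N.toNNReal := by
    gcongr
    exact le_add_self.trans le_self_add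
  obtain ⟨w, hw, hwn⟩ := exists_fracSobolevSpace_of_sobFamily hp
    (B := (C₁ + C₂ + 1) * N.toNNReal)
    ⟨fun j hj => (hg.1 j hj).mono hb1, hg.2⟩ (hV.mono hb2) hVw
  refine ⟨w, ?_, ?_, hwn.trans (le_of_eq ?_)⟩
  · filter_upwards [hw, (ae_restrict_iff' hΩ.measurableSet).1 hu0] with x hx hx0 hxΩ
    rw [hx, ← hx0 hxΩ]
    rfl
  · filter_upwards [hw] with x hx hx0
    rw [hx]
    show ψ x * _ = 0
    rw [hx0, zero_mul]
  · push_cast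
    rw [Real.coe_toNNReal _ hN]
    ring

/-- Extension from a shrunken interval, supported in a slightly larger one. -/
theorem exists_interval_extension {a b δ : ℝ} (hδ : 0 < δ) (hδab : 4 * δ < b - a) {p : ℝ≥0∞}
    (hp : 1 ≤ p) (s : Side) {α : ℝ} (hα : 0 < α) :
    ∃ C : ℝ, 0 < C ∧ ∀ u : fracSobolevSpace s α p (Ioo a b),
      ∃ w : fracSobolevSpace s α p (univ : Set ℝ),
        (∀ᵐ x, x ∈ Icc (a + 2 * δ) (b - 2 * δ) → w.1 x = u.1 x) ∧
        essSupport w.1 ⊆ Icc (a + δ) (b - δ) ∧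
        fracSobolevNorm s α w.1 ≤ C * fracSobolevNorm s α u.1 := by
  -- `ψ` is `1` on `[a + 2δ, b - 2δ]` with support `[a + δ, b - δ]`; `χ` is `1` on `[a + 2δ/3, b -
  -- 2δ/3]`. The gap `δ/3` is twice the separation parameter `δ/6` used below.
  let ψ : ContDiffBump ((a + b) / 2) :=
    ⟨(b - a) / 2 - 2 * δ, (b - a) / 2 - δ, by linarith, by linarith⟩
  let χ : ContDiffBump ((a + b) / 2) :=
    ⟨(b - a) / 2 - 2 / 3 * δ, (b - a) / 2 - 1 / 3 * δ, by linarith, by linarith⟩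
  have hψt : IsTestFunction (Ioo a b) ψ := by
    refine ⟨ψ.contDiff, ψ.hasCompactSupport, ?_⟩
    rw [ψ.tsupport_eq, Real.closedBall_eq_Icc]
    intro x hx
    have h1 : (a + b) / 2 - ((b - a) / 2 - δ) ≤ x := hx.1
    have h2 : x ≤ (a + b) / 2 + ((b - a) / 2 - δ) := hx.2
    constructor <;> linarith
  have hχt : IsTestFunction (Ioo a b) χ := by
    refine ⟨χ.contDiff, χ.hasCompactSupport, ?_⟩
    rw [χ.tsupport_eq, Real.closedBall_eq_Icc]
    intro x hx
    have h1 : (a + b) / 2 - ((b - a) / 2 - 1 / 3 * δ) ≤ x := hx.1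
    have h2 : x ≤ (a + b) / 2 + ((b - a) / 2 - 1 / 3 * δ) := hx.2
    constructor <;> linarith
  have hψ0 : ∀ x, (b - a) / 2 - δ ≤ |x - (a + b) / 2| → ψ x = 0 := fun x hx =>
    ψ.zero_of_le_dist hx
  obtain ⟨C, hC, hCu⟩ := exists_cutoff_extension hp isOpen_Ioo hψt hχt (δ := δ / 6) (by linarith)
    (fun x t hx ht => by
      apply hψ0
      have h1 : (b - a) / 2 - 2 / 3 * δ < |x - (a + b) / 2| := by
        by_contra h
        exact hx (χ.one_of_mem_closedBall (by
          rw [Metric.mem_closedBall, Real.dist_eq]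
          exact not_lt.1 h))
      have h2 : |x - (a + b) / 2| ≤ |x + t - (a + b) / 2| + |t| := by
        have := abs_sub (x + t - (a + b) / 2) t
        rwa [show x + t - (a + b) / 2 - t = x - (a + b) / 2 by ring] at this
      linarith) s hα
  refine ⟨C, hC, fun u => ?_⟩
  obtain ⟨w, hw1, hw0, hwn⟩ := hCu u
  refine ⟨w, ?_, ?_, hwn⟩
  · filter_upwards [hw1] with x hx hxI
    rw [hx ⟨by linarith [hxI.1], by linarith [hxI.2]⟩, ψ.one_of_mem_closedBall, one_mul]
    rw [Real.closedBall_eq_Icc]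
    constructor
    · show (a + b) / 2 - ((b - a) / 2 - 2 * δ) ≤ x
      linarith [hxI.1]
    · show x ≤ (a + b) / 2 + ((b - a) / 2 - 2 * δ)
      linarith [hxI.2]
  · intro x hx
    by_contra hxI
    refine hx _ isClosed_Icc.isOpen_compl hxI ?_
    filter_upwards [hw0] with y hy hyI
    apply hy
    apply hψ0
    by_contra h
    have := abs_lt.1 (not_le.1 h)
    exact hyI ⟨by linarith [this.1], by linarith [this.2]⟩

/-- A nonempty compact subset of `(a, b)` contains its infimum and supremum, which are therefore
interior. The cap `(b - a) / 8` keeps the shrunken intervals nondegenerate. -/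
theorem exists_margin {a b : ℝ} (hab : a < b) {T : Set ℝ} (hT : IsCompact T) (hTs : T ⊆ Ioo a b) :
    ∃ δ, 0 < δ ∧ 4 * δ < b - a ∧ T ⊆ Icc (a + 2 * δ) (b - 2 * δ) := by
  rcases T.eq_empty_or_nonempty with rfl | hne
  · exact ⟨(b - a) / 8, by linarith, by linarith, empty_subset _⟩
  · have h1 := hTs (hT.sInf_mem hne)
    have h2 := hTs (hT.sSup_mem hne)
    refine ⟨min ((b - a) / 8) (min ((sInf T - a) / 2) ((b - sSup T) / 2)), ?_, ?_, ?_⟩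
    · exact lt_min (by linarith) (lt_min (by linarith [h1.1]) (by linarith [h2.2]))
    · have := min_le_left ((b - a) / 8) (min ((sInf T - a) / 2) ((b - sSup T) / 2))
      linarith
    · have h3 := min_le_right ((b - a) / 8) (min ((sInf T - a) / 2) ((b - sSup T) / 2))
      have h4 := h3.trans (min_le_left _ _)
      have h5 := h3.trans (min_le_right _ _)
      intro x hx
      have h6 := csInf_le hT.bddBelow hx
      have h7 := le_csSup hT.bddAbove hx
      constructor <;> linarith

end FracSob

theorem mainTheorem3 (a b : ℝ) (hab : a < b) :
    ∃ C : ℝ → ℝ≥0∞ → Set ℝ → ℝ, (∀ α p K, 0 < C α p K) ∧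
      ∀ Ω' : Set ℝ, IsCompact (closure Ω') → closure Ω' ⊆ Ioo a b →
        ∃ K : Set ℝ, IsCompact K ∧ K ⊆ Ioo a b ∧
          ∀ (α : ℝ) (p : ℝ≥0∞), 0 < α → 1 ≤ p → ∀ s : FracSob.Side,
            ∃ E : FracSob.fracSobolevSpace s α p (Ioo a b) →
                FracSob.fracSobolevSpace s α p (univ : Set ℝ),
              ∀ u : FracSob.fracSobolevSpace s α p (Ioo a b),
                (∀ᵐ x : ℝ, x ∈ Ω' → (E u).1 x = u.1 x) ∧
                FracSob.essSupport (E u).1 ⊆ K ∧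
                FracSob.fracSobolevNorm s α (E u).1 ≤
                  C α p K * FracSob.fracSobolevNorm s α u.1 := by
  -- The constant is fixed before the direction and the function, for every real `δ`; it is the
  -- default `1` outside the admissible range, and the sum of the two one-sided constants inside it.
  have hconst : ∀ (α : ℝ) (p : ℝ≥0∞) (δ : ℝ), ∃ C : ℝ, 0 < C ∧
      (0 < δ → 4 * δ < b - a → 0 < α → 1 ≤ p → ∀ s : FracSob.Side,
        ∀ u : FracSob.fracSobolevSpace s α p (Ioo a b),
          ∃ w : FracSob.fracSobolevSpace s α p (univ : Set ℝ),
            (∀ᵐ x, x ∈ Icc (a + 2 * δ) (b - 2 * δ) → w.1 x = u.1 x) ∧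
            FracSob.essSupport w.1 ⊆ Icc (a + δ) (b - δ) ∧
            FracSob.fracSobolevNorm s α w.1 ≤ C * FracSob.fracSobolevNorm s α u.1) := by
    intro α p δ
    by_cases h : 0 < δ ∧ 4 * δ < b - a ∧ 0 < α ∧ 1 ≤ p
    · obtain ⟨h1, h2, h3, h4⟩ := h
      choose C hC hCu using fun s => FracSob.exists_interval_extension h1 h2 h4 s h3
      refine ⟨C .left + C .right, add_pos (hC _) (hC _), fun _ _ _ _ s u => ?_⟩
      obtain ⟨w, hw1, hw2, hw3⟩ := hCu s u
      refine ⟨w, hw1, hw2, hw3.trans ?_⟩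
      refine mul_le_mul_of_nonneg_right ?_ (FracSob.fracSobolevNorm_nonneg h4 s α u.1)
      cases s
      · linarith [hC .right]
      · linarith [hC .left]
    · exact ⟨1, one_pos, fun h1 h2 h3 h4 => absurd ⟨h1, h2, h3, h4⟩ h⟩
  choose C hC hCu using hconst
  -- The constant may see only `K`. With `K = [a + δ, b - δ]` the margin is recovered as `δ = inf K
  -- - a`.
  refine ⟨fun α p K => C α p (sInf K - a), fun α p K => hC _ _ _, fun Ω' hc hs => ?_⟩
  obtain ⟨δ, h1, h2, h3⟩ := FracSob.exists_margin hab hc hs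
  refine ⟨Icc (a + δ) (b - δ), isCompact_Icc,
    fun x hx => ⟨by linarith [hx.1], by linarith [hx.2]⟩, fun α p hα hp s => ?_⟩
  choose E hE using hCu α p δ h1 h2 hα hp s
  refine ⟨E, fun u => ⟨?_, (hE u).2.1, ?_⟩⟩
  · filter_upwards [(hE u).1] with x hx hxΩ
    exact hx (h3 (subset_closure hxΩ))
  · have hK : sInf (Icc (a + δ) (b - δ)) - a = δ := by
      rw [csInf_Icc (by linarith)]
      ring
    simp only [hK]
    exact (hE u).2.2
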